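/- Conventions. For a Hermitian $n\times n$ complex matrix $H$ let $\lambda_1(H)\ge\dots\ge\lambda_n(H)$ be its eigenvalues in decreasing order, with multiplicity. For $x\in\mathbb R$ let $\|x\|_{\mathbb R/\mathbb Z}$ denote the distance from $x$ to the nearest integer. For $\delta>0$, a positive semidefinite $n\times n$ complex matrix $A$ is called $\delta$-separated if $\lambda_1(A)>\dots>\lambda_n(A)$, $\lambda_j(A)-\lambda_{j+1}(A)\ge\delta$ for all $j<n$, and $\lambda_1(A)\le 1-\delta$. For $\alpha>4$, an integer $m$ is said to separate $k$ in the Hermitian matrix $H$ (with respect to $B_{in}(\alpha),B_{out}$) if $m>0$, $$m\lambda_k(H) \bmod 1\in B_{in}(\alpha)=\Big[-\tfrac1{\alpha n},\tfrac1{\alpha n}\Big]\bmod 1,\qquad m\lambda_j(H)\bmod 1\notin B_{out}=\Big[-\tfrac1{4n},\tfrac1{4n}\Big]\bmod 1\ \text{ for all } j\ne k,$$ that is, $\|m\lambda_k(H)\|_{\mathbb R/\mathbb Z}\le \frac1{\alpha n}$ and $\|m\lambda_j(H)\|_{\mathbb R/\mathbb Z}>\frac1{4n}$ for all $j\neq k$.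 A GUE matrix is a random Hermitian $n\times n$ matrix whose entries on and above the diagonal are independent, the diagonal ones being standard real Gaussians and the off-diagonal ones standard complex Gaussians (independent real and imaginary parts of mean $0$ and variance $1/2$). Theorem. Let $A$ be a $\delta$-separated positive semidefinite $n\times n$ matrix with $\delta>0$, let $0<\zeta\le\min\{\delta^{13},n^{-50}\}$, let $4<\alpha\le n$, and let $M$ be an integer with $M\ge\zeta^{-1.6}$. Let $\mathcal E$ be a GUE matrix and let $m$ be uniformly distributed on $\{0,1,\dots,M-1\}$, independent of $\mathcal E$. Then for every $k\in\{1,\dots,n\}$, $$\mathbb P_{\mathcal E,m}\big(m\text{ separates }k\text{ in }A+\zeta\mathcal E\text{ w.r.t. }B_{in}(\alpha),B_{out}\big)\ \ge\ \frac1{5\alpha n}.$$ -/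

import Mathlib

open MeasureTheory ProbabilityTheory
open scoped ComplexOrder

noncomputable section

/-- The entrywise (product) sigma-algebra on complex matrices. -/
instance matrixMeasurableSpace {n : ℕ} : MeasurableSpace (Matrix (Fin n) (Fin n) ℂ) :=
  inferInstanceAs (MeasurableSpace (Fin n → Fin n → ℂ))

/-- The eigenvalues `λ₁ ≥ λ₂ ≥ … ≥ λₙ` of a Hermitian matrix with multiplicity, in decreasing
order; the largest one has index `0`. -/
def sortedEigenvalues {n : ℕ} {A : Matrix (Fin n) (Fin n) ℂ} (hA : A.IsHermitian) : Fin n → ℝ :=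
  fun i => hA.eigenvalues₀ (Fin.cast (Fintype.card_fin n).symm i)

theorem sortedEigenvalues_antitone {n : ℕ} {A : Matrix (Fin n) (Fin n) ℂ} (hA : A.IsHermitian) :
    Antitone (sortedEigenvalues hA) :=
  fun _ _ hij => hA.eigenvalues₀_antitone hij

/-- A positive semidefinite matrix is `δ`-separated if its eigenvalues `λ₁ > … > λₙ` are distinct,
consecutive ones are at distance at least `δ`, and the largest is at most `1 - δ`. -/
structure IsSeparatedMatrix {n : ℕ} (δ : ℝ) (A : Matrix (Fin n) (Fin n) ℂ) : Prop where
  posSemidef : A.PosSemidef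
  strictAnti : StrictAnti (sortedEigenvalues posSemidef.isHermitian)
  gap : ∀ i j : Fin n, (i : ℕ) + 1 = (j : ℕ) →
    δ ≤ sortedEigenvalues posSemidef.isHermitian i - sortedEigenvalues posSemidef.isHermitian j
  top_le : ∀ i : Fin n, (i : ℕ) = 0 → sortedEigenvalues posSemidef.isHermitian i ≤ 1 - δ

/-- The set of fractional parts of the points of `[-1/(αn), 1/(αn)]`. -/
def bIn (n : ℕ) (α : ℝ) : Set ℝ :=
  Int.fract '' Set.Icc (-(1 / (α * n))) (1 / (α * n))

/-- The arc modulo `1` that runs from `1 - 1/(4n)` through `1 ≡ 0` to `-1 + 1/(4n) ≡ 1 + 1/(4n)`,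
as a set of fractional parts: the residues at distance at most `1/(4n)` from `0`. -/
def bOut (n : ℕ) : Set ℝ :=
  Int.fract '' Set.Icc (1 - 1 / (4 * n : ℝ)) (1 + 1 / (4 * n : ℝ))

/-- The positive integer `m` separates the `k`-th element of the sequence `l`. -/
def Separates {n : ℕ} (α : ℝ) (l : Fin n → ℝ) (k : Fin n) (m : ℕ) : Prop :=
  0 < m ∧ Int.fract (m * l k) ∈ bIn n α ∧ ∀ j : Fin n, j ≠ k → Int.fract (m * l j) ∉ bOut n

/-- `A` is Hermitian and `m` separates the `k`-th of its sorted eigenvalues. -/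
def SeparatesEigenvalue {n : ℕ} (α : ℝ) (A : Matrix (Fin n) (Fin n) ℂ) (k : Fin n) (m : ℕ) :
    Prop :=
  ∃ hA : A.IsHermitian, Separates α (sortedEigenvalues hA) k m

/-- The Hermitian matrix built from a real array `g`: the diagonal is that of `g`, and for `i < j`
the entry at `(i, j)` is `(g i j + √-1 * g j i) / √2`. -/
def hermitianOfReal {n : ℕ} (g : Fin n → Fin n → ℝ) : Matrix (Fin n) (Fin n) ℂ :=
  Matrix.of fun i j =>
    if i = j then (g i i : ℂ)
    else if i < j then ((g i j : ℂ) + (g j i : ℂ) * Complex.I) / (Real.sqrt 2 : ℂ)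
    else ((g j i : ℂ) - (g i j : ℂ) * Complex.I) / (Real.sqrt 2 : ℂ)

/-- The Gaussian unitary ensemble: the law of a random Hermitian matrix whose entries on and above
the diagonal are independent, the diagonal ones standard real Gaussian, the others standard complex
Gaussian (real and imaginary part independent of variance `1/2`). -/
def gue (n : ℕ) : Measure (Matrix (Fin n) (Fin n) ℂ) :=
  (Measure.pi fun _ : Fin n => Measure.pi fun _ : Fin n => gaussianReal 0 1).map hermitianOfReal

theorem hermitianOfReal_isHermitian {n : ℕ} (g : Fin n → Fin n → ℝ) :
    (hermitianOfReal g).IsHermitian := by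
  ext i j
  simp only [hermitianOfReal, Matrix.conjTranspose_apply, Matrix.of_apply]
  rcases lt_trichotomy i j with h | h | h
  · simp [h.ne, h.ne', h, not_lt.mpr h.le, sub_eq_add_neg]
  · subst h; simp
  · simp [h.ne, h.ne', h, not_lt.mpr h.le, sub_eq_add_neg]

theorem measurable_hermitianOfReal {n : ℕ} :
    Measurable (hermitianOfReal : (Fin n → Fin n → ℝ) → Matrix (Fin n) (Fin n) ℂ) := by
  have key : ∀ i j, Measurable fun g : Fin n → Fin n → ℝ => hermitianOfReal g i j := by
    intro i j
    simp only [hermitianOfReal, Matrix.of_apply]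
    split_ifs <;> fun_prop
  exact measurable_pi_lambda _ fun i => measurable_pi_lambda _ fun j => key i j

instance isProbabilityMeasure_gue {n : ℕ} : IsProbabilityMeasure (gue n) :=
  Measure.isProbabilityMeasure_map measurable_hermitianOfReal.aemeasurable

end

/-! With probability at least 9/10 the perturbed eigenvalues are nonresonant: no combination `b λ_k
+ c λ_j` with integers `|b|, |c| ≤ n^8`, not both zero, lies within `t = n^9 ζ^1.6 / 2` of an
integer. The pairs `(m λ_k, m λ_j)` mod 1 with `m < M` are then nearly equidistributed on the
2-torus as soon as `M ≥ n^9 / (2t) = ζ^(-1.6)`.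

Pairs suffice for counting. If `f` is a tent supported on the inner arc and `g` a trapezoid equal to
1 on the outer arc, the indicator of separation is at least `f(m λ_k) (1 - ∑ g(m λ_j))`, in which
only two eigenvalues meet at a time. The means of `f` and `g` are `c = 1/(αn)` and `5/(8n)`, so the
average is at least `3c/8` up to errors of at most `c/10` in total; hence at least `M c / 4` values
of `m` separate (`card_separates_ge`).

Nonresonance comes from the noise. To first order `λ_i` moves by `ζ ⟨a_i, G a_i⟩`, with a quadratic
error from the Kato-Temple inequality (`abs_sortedEigenvalues_add_smul_sub_le`). In an eigenbasis of
`A` the diagonal of a GUE matrix consists of independent standard Gaussians, so the shift of `b λ_k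
+ c λ_j` is `ζ` times a Gaussian of variance `b² + c² ≥ 1`, which rarely hits a prescribed short
interval (`gue_abs_quadForm_sub_lt_le`). A union bound over `j, b, c` and Markov's inequality for
the norm finish, as `9/10 · 1/4 > 1/5`. -/

/-! ### Distance to the nearest integer and the two arcs -/

/-- The distance from a real number to the nearest integer. -/
noncomputable def distInt (x : ℝ) : ℝ := |x - round x|

theorem distInt_nonneg (x : ℝ) : 0 ≤ distInt x := abs_nonneg _

theorem distInt_le_half (x : ℝ) : distInt x ≤ 1 / 2 := abs_sub_round x

theorem distInt_le (x : ℝ) (z : ℤ) : distInt x ≤ |x - z| := round_le x z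

theorem fract_mem_bIn {n : ℕ} {α x : ℝ} (h : distInt x ≤ 1 / (α * n)) : Int.fract x ∈ bIn n α := by
  refine ⟨x - round x, abs_le.mp h, ?_⟩
  rw [Int.fract_sub_intCast]

theorem distInt_le_of_fract_mem_bOut {n : ℕ} {x : ℝ} (h : Int.fract x ∈ bOut n) :
    distInt x ≤ 1 / (4 * n) := by
  obtain ⟨y, hy, hxy⟩ := h
  obtain ⟨z, hz⟩ := Int.fract_eq_fract.mp hxy.symm
  refine (distInt_le x (z + 1)).trans (abs_le.mpr ?_)
  push_cast
  constructor <;> linarith [hy.1, hy.2]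

/-! ### Fourier approximation of the tent function -/

/-- The periodised triangle function of half-width `h` and height `h`. -/
noncomputable def triangle (h x : ℝ) : ℝ := max 0 (h - distInt x)

/-- The partial sums of the Fourier series of the second Bernoulli function. -/
noncomputable def cosSum (K : ℕ) (x : ℝ) : ℝ :=
  ∑ n ∈ Finset.range (K + 1), 1 / (n : ℝ) ^ 2 * Real.cos (2 * Real.pi * n * x)

/-- Evenness carries the Fourier series of the second Bernoulli polynomial from `[0, 1]` to `[-1,
1]`, the range of the shifted arguments `y ± h` used below. -/
theorem hasSum_cos_div_sq {x : ℝ} (hx : |x| ≤ 1) :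
    HasSum (fun n : ℕ => 1 / (n : ℝ) ^ 2 * Real.cos (2 * Real.pi * n * x))
      (Real.pi ^ 2 * (x ^ 2 - |x| + 1 / 6)) := by
  have h := hasSum_one_div_nat_pow_mul_cos one_ne_zero (x := |x|) ⟨abs_nonneg x, hx⟩
  have hb : Polynomial.bernoulli 2 = Polynomial.X ^ 2 - Polynomial.X + Polynomial.C (1 / 6) := by
    rw [Polynomial.bernoulli, Finset.sum_range_succ, Finset.sum_range_succ, Finset.sum_range_one]
    norm_num [bernoulli_eq_bernoulli'_of_ne_one, bernoulli_one, bernoulli_zero, Nat.choose,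
      bernoulli'_two, ← Polynomial.C_mul_X_pow_eq_monomial]
    ring
  convert h using 1
  · funext n
    have : Real.cos (2 * Real.pi * n * |x|) = Real.cos (2 * Real.pi * n * x) := by
      rcases abs_choice x with h | h <;> rw [h]
      rw [mul_neg, Real.cos_neg]
    rw [this, mul_one]
  · rw [mul_one, hb]
    have hf : ((Nat.factorial 2 : ℕ) : ℝ) = 2 := by norm_num [Nat.factorial]
    have he : (Polynomial.map (algebraMap ℚ ℝ)
        (Polynomial.X ^ 2 - Polynomial.X + Polynomial.C (1 / 6))).eval |x| = x ^ 2 - |x| + 1 / 6 := by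
      simp
    rw [hf, he]
    ring

theorem abs_cosSum_sub_le {K : ℕ} (hK : K ≠ 0) {x : ℝ} (hx : |x| ≤ 1) :
    |Real.pi ^ 2 * (x ^ 2 - |x| + 1 / 6) - cosSum K x| ≤ (1 / K : ℝ) := by
  have h := (hasSum_cos_div_sq hx).tendsto_sum_nat
  refine le_of_tendsto ((h.sub_const (cosSum K x)).abs) ?_
  filter_upwards [Filter.eventually_ge_atTop (K + 1)] with N hN
  rw [cosSum, ← Finset.sum_Ico_eq_sub _ hN]
  calc _ ≤ ∑ i ∈ Finset.Ico (K + 1) N, ((i : ℝ) ^ 2)⁻¹ := by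
        refine (Finset.abs_sum_le_sum_abs _ _).trans (Finset.sum_le_sum fun i _ => ?_)
        rw [abs_mul, one_div, abs_of_nonneg (by positivity : (0 : ℝ) ≤ ((i : ℝ) ^ 2)⁻¹)]
        exact mul_le_of_le_one_right (by positivity) (Real.abs_cos_le_one _)
    _ ≤ ∑ i ∈ Finset.Ioc K N, ((i : ℝ) ^ 2)⁻¹ :=
        Finset.sum_le_sum_of_subset_of_nonneg (by intro i; simp; omega) (by intros; positivity)
    _ ≤ (K : ℝ)⁻¹ - (N : ℝ)⁻¹ := sum_Ioc_inv_sq_le_sub hK (by omega)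
    _ ≤ 1 / K := by rw [one_div]; linarith [inv_nonneg.mpr (Nat.cast_nonneg (α := ℝ) N)]

/-- The Fourier coefficients of `triangle h`. -/
noncomputable def triangleCoeff (h : ℝ) (n : ℕ) : ℝ :=
  if n = 0 then h ^ 2 else (1 - Real.cos (2 * Real.pi * n * h)) / (Real.pi ^ 2 * (n : ℝ) ^ 2)

/-- For `n ≥ 1` the coefficients are at most `2 / (π² n²)`, and `ζ(2) = π² / 6`. The bound is
uniform in `K`, so raising the degree costs nothing in the exponential sums. -/
theorem sum_abs_triangleCoeff_le (h : ℝ) (K : ℕ) :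
    ∑ n ∈ Finset.range (K + 1), |triangleCoeff h n| ≤ h ^ 2 + 1 / 3 := by
  rw [Finset.sum_range_succ']
  have h0 : |triangleCoeff h 0| = h ^ 2 := by simp [triangleCoeff]
  rw [h0, add_comm]
  gcongr
  have key : ∀ n : ℕ, |triangleCoeff h (n + 1)| ≤ 2 / Real.pi ^ 2 * (1 / ((n + 1 : ℕ) : ℝ) ^ 2) := by
    intro n
    have hc := Real.cos_le_one (2 * Real.pi * (n + 1 : ℕ) * h)
    have hc' := Real.neg_one_le_cos (2 * Real.pi * (n + 1 : ℕ) * h)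
    rw [triangleCoeff, if_neg (by omega), abs_of_nonneg (div_nonneg (by linarith) (by positivity)),
      div_mul_div_comm, mul_one]
    gcongr
    linarith
  refine (Finset.sum_le_sum fun n _ => key n).trans ?_
  rw [← Finset.mul_sum]
  have hs := (hasSum_nat_add_iff' (f := fun n : ℕ => 1 / (n : ℝ) ^ 2) 1).mpr hasSum_zeta_two
  have := sum_le_hasSum (Finset.range K) (fun _ _ => by positivity) hs
  simp only [Finset.range_one, Finset.sum_singleton] at this
  have hp := Real.pi_pos
  calc _ ≤ 2 / Real.pi ^ 2 * (Real.pi ^ 2 / 6) := by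
        gcongr; simpa using this
    _ = 1 / 3 := by field_simp; norm_num

theorem cos_two_pi_mul_round_sub (n : ℕ) (x : ℝ) :
    Real.cos (2 * Real.pi * n * (x - round x)) = Real.cos (2 * Real.pi * n * x) := by
  have := Real.cos_sub_int_mul_two_pi (2 * Real.pi * n * x) (n * round x)
  rw [← this]
  congr 1
  push_cast
  ring

/-- A tent is half a second difference of the absolute value; this turns the Bernoulli series into a
series for the tent. -/
theorem max_zero_sub_abs {h : ℝ} (h0 : 0 ≤ h) (y : ℝ) :
    max 0 (h - |y|) = (|y + h| + |y - h|) / 2 - |y| := by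
  rcases abs_cases y with ⟨a, a'⟩ | ⟨a, a'⟩ <;> rcases abs_cases (y + h) with ⟨b, b'⟩ | ⟨b, b'⟩ <;>
    rcases abs_cases (y - h) with ⟨c, c'⟩ | ⟨c, c'⟩ <;> rw [a, b, c] <;>
    first
    | (rw [max_eq_left (by linarith)]; linarith)
    | (rw [max_eq_right (by linarith)]; linarith)

theorem abs_triangle_sub_le {h : ℝ} (h0 : 0 ≤ h) (h2 : h ≤ 1 / 2) {K : ℕ} (hK : K ≠ 0) (x : ℝ) :
    |triangle h x - ∑ n ∈ Finset.range (K + 1), triangleCoeff h n * Real.cos (2 * Real.pi * n * x)|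
      ≤ 1 / K := by
  set y := x - round x with hy
  have hy2 : |y| ≤ 1 / 2 := abs_sub_round x
  have hp := Real.pi_pos
  have hp3 := Real.pi_gt_three
  have e1 := abs_cosSum_sub_le hK (x := y) (by linarith)
  have e2 := abs_cosSum_sub_le hK (x := y + h)
    ((abs_add_le _ _).trans (by rw [abs_of_nonneg h0]; linarith))
  have e3 := abs_cosSum_sub_le hK (x := y - h)
    ((abs_sub _ _).trans (by rw [abs_of_nonneg h0]; linarith))
  have et : triangle h x = h ^ 2 - (((y + h) ^ 2 - |y + h| + 1 / 6) + ((y - h) ^ 2 - |y - h| + 1 / 6)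
      - 2 * (y ^ 2 - |y| + 1 / 6)) / 2 := by
    have : triangle h x = max 0 (h - |y|) := rfl
    rw [this, max_zero_sub_abs h0 y]
    ring
  have es : ∑ n ∈ Finset.range (K + 1), triangleCoeff h n * Real.cos (2 * Real.pi * n * x)
      = h ^ 2 - (cosSum K (y + h) + cosSum K (y - h) - 2 * cosSum K y) / (2 * Real.pi ^ 2) := by
    rw [Finset.sum_range_succ']
    simp only [cosSum, Finset.mul_sum]
    rw [← Finset.sum_add_distrib, ← Finset.sum_sub_distrib, Finset.sum_div, Finset.sum_range_succ']
    have z0 : triangleCoeff h 0 * Real.cos (2 * Real.pi * (0 : ℕ) * x) = h ^ 2 := by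
      simp [triangleCoeff]
    rw [z0]
    have : ∀ n : ℕ, triangleCoeff h (n + 1) * Real.cos (2 * Real.pi * (n + 1 : ℕ) * x) =
        -((1 / ((n + 1 : ℕ) : ℝ) ^ 2 * Real.cos (2 * Real.pi * (n + 1 : ℕ) * (y + h)) +
          1 / ((n + 1 : ℕ) : ℝ) ^ 2 * Real.cos (2 * Real.pi * (n + 1 : ℕ) * (y - h)) -
          2 * (1 / ((n + 1 : ℕ) : ℝ) ^ 2 * Real.cos (2 * Real.pi * (n + 1 : ℕ) * y))) /
          (2 * Real.pi ^ 2)) := by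
      intro n
      rw [triangleCoeff, if_neg (by omega), ← cos_two_pi_mul_round_sub (n + 1) x, ← hy,
        mul_add _ y h, mul_sub _ y h, Real.cos_add, Real.cos_sub]
      field_simp
      ring
    rw [Finset.sum_congr rfl fun n _ => this n, Finset.sum_neg_distrib]
    simp
    ring
  have hK' : (0 : ℝ) < K := by positivity
  rw [et, es]
  have hd : h ^ 2 - (((y + h) ^ 2 - |y + h| + 1 / 6) + ((y - h) ^ 2 - |y - h| + 1 / 6)
      - 2 * (y ^ 2 - |y| + 1 / 6)) / 2 -
      (h ^ 2 - (cosSum K (y + h) + cosSum K (y - h) - 2 * cosSum K y) / (2 * Real.pi ^ 2)) =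
      (2 * (Real.pi ^ 2 * (y ^ 2 - |y| + 1 / 6) - cosSum K y)
        - (Real.pi ^ 2 * ((y + h) ^ 2 - |y + h| + 1 / 6) - cosSum K (y + h))
        - (Real.pi ^ 2 * ((y - h) ^ 2 - |y - h| + 1 / 6) - cosSum K (y - h))) / (2 * Real.pi ^ 2) := by
    field_simp
    ring
  rw [hd, abs_div, abs_of_pos (by positivity : 0 < 2 * Real.pi ^ 2), div_le_iff₀ (by positivity)]
  have hk : 0 < 1 / (K : ℝ) := by positivity
  have : |2 * (Real.pi ^ 2 * (y ^ 2 - |y| + 1 / 6) - cosSum K y)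
        - (Real.pi ^ 2 * ((y + h) ^ 2 - |y + h| + 1 / 6) - cosSum K (y + h))
        - (Real.pi ^ 2 * ((y - h) ^ 2 - |y - h| + 1 / 6) - cosSum K (y - h))| ≤ (4 * (1 / K) : ℝ) := by
    rw [abs_le] at e1 e2 e3 ⊢
    constructor <;> linarith [e1.1, e1.2, e2.1, e2.2, e3.1, e3.2]
  -- The three truncation errors have weights 2, 1, 1, so the total `4/K` over `2π²` is at most
  -- `1/K`.
  have hp2 : 2 ≤ Real.pi ^ 2 := by nlinarith
  refine this.trans ?_
  nlinarith

/-! ### Exponential sums and equidistribution -/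

/-- Multiplying by `2 sin(πθ)` makes the sum telescope, and Jordan's inequality gives `|sin(πθ)| ≥ 2
distInt θ`. -/
theorem abs_sum_cos_le {θ t : ℝ} (ht : 0 < t) (hθ : t ≤ distInt θ) (M : ℕ) :
    |∑ m ∈ Finset.range M, Real.cos (2 * Real.pi * (m * θ))| ≤ 1 / (2 * t) := by
  set s := Real.sin (Real.pi * θ) with hs
  have hp := Real.pi_pos
  have hsin : 2 * t ≤ |s| := by
    have h1 : |s| = |Real.sin (Real.pi * (θ - round θ))| := by
      have : Real.pi * (θ - round θ) = Real.pi * θ - round θ * Real.pi := by ring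
      rw [this, Real.sin_sub_int_mul_pi, abs_mul, abs_zpow]
      simp [hs]
    have h2 : |Real.sin (Real.pi * (θ - round θ))| = |Real.sin (Real.pi * distInt θ)| := by
      unfold distInt
      rcases abs_choice (θ - round θ) with h | h <;> rw [h]
      rw [mul_neg, Real.sin_neg, abs_neg]
    have h3 := Real.mul_le_sin (x := Real.pi * distInt θ)
      (mul_nonneg hp.le (distInt_nonneg θ)) (by nlinarith [distInt_le_half θ])
    rw [h1, h2]
    refine le_trans ?_ (h3.trans (le_abs_self _))
    have : 2 / Real.pi * (Real.pi * distInt θ) = 2 * distInt θ := by field_simp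
    rw [this]
    linarith
  have hsum : ∀ M : ℕ, 2 * s * ∑ m ∈ Finset.range M, Real.cos (2 * Real.pi * (m * θ)) =
      Real.sin ((2 * M - 1) * (Real.pi * θ)) + s := by
    intro M
    induction M with
    | zero => simp [hs]
    | succ M ih =>
      rw [Finset.sum_range_succ, mul_add, ih]
      have e1 : (2 * ((M + 1 : ℕ) : ℝ) - 1) * (Real.pi * θ) =
        2 * Real.pi * (M * θ) + Real.pi * θ := by push_cast; ring
      have e2 : (2 * (M : ℝ) - 1) * (Real.pi * θ) =
        2 * Real.pi * (M * θ) - Real.pi * θ := by ring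
      rw [e1, e2, Real.sin_add, Real.sin_sub]
      ring
  have hM := congrArg abs (hsum M)
  rw [abs_mul, abs_mul, abs_two] at hM
  have h1 := Real.abs_sin_le_one ((2 * (M : ℝ) - 1) * (Real.pi * θ))
  have h2 := abs_add_le (Real.sin ((2 * (M : ℝ) - 1) * (Real.pi * θ))) s
  have h3 : |s| ≤ 1 := Real.abs_sin_le_one _
  rw [le_div_iff₀ (by linarith)]
  nlinarith [abs_nonneg (∑ m ∈ Finset.range M, Real.cos (2 * Real.pi * (m * θ)))]

/-- The even trigonometric polynomial of degree at most `K` with coefficients `u`. -/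
noncomputable def cosPoly (u : ℕ → ℝ) (K : ℕ) (x : ℝ) : ℝ :=
  ∑ n ∈ Finset.range (K + 1), u n * Real.cos (2 * Real.pi * n * x)

/-- Here `e i` is the exponential sum at frequency `i`: it is `M` at frequency zero and at most `T`
elsewhere. -/
theorem abs_sum_le_of_abs_sub_ite_le {ι : Type*} [DecidableEq ι] {s : Finset ι} {i₀ : ι}
    (hi₀ : i₀ ∈ s) (w e : ι → ℝ) {M T : ℝ}
    (he : ∀ i ∈ s, |e i - if i = i₀ then M else 0| ≤ T) :
    |∑ i ∈ s, w i * e i - M * w i₀| ≤ T * ∑ i ∈ s, |w i| := by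
  have : ∑ i ∈ s, w i * e i - M * w i₀ = ∑ i ∈ s, w i * (e i - if i = i₀ then M else 0) := by
    simp only [mul_sub, Finset.sum_sub_distrib, mul_ite, mul_zero]
    rw [Finset.sum_ite_eq' s i₀, if_pos hi₀]
    ring
  rw [this, Finset.mul_sum]
  refine (Finset.abs_sum_le_sum_abs _ _).trans (Finset.sum_le_sum fun i hi => ?_)
  rw [abs_mul, mul_comm]
  exact mul_le_mul_of_nonneg_right (he i hi) (abs_nonneg _)

theorem abs_sum_cosPoly_sub_le {K : ℕ} {x t : ℝ} (ht : 0 < t)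
    (h : ∀ a : ℕ, a ≤ K → a ≠ 0 → t ≤ distInt (a * x)) (u : ℕ → ℝ) (M : ℕ) :
    |∑ m ∈ Finset.range M, cosPoly u K (m * x) - M * u 0|
      ≤ 1 / (2 * t) * ∑ n ∈ Finset.range (K + 1), |u n| := by
  have : ∑ m ∈ Finset.range M, cosPoly u K (m * x) = ∑ n ∈ Finset.range (K + 1),
      u n * ∑ m ∈ Finset.range M, Real.cos (2 * Real.pi * (m * (n * x))) := by
    simp only [cosPoly]
    rw [Finset.sum_comm]
    refine Finset.sum_congr rfl fun n _ => ?_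
    rw [Finset.mul_sum]
    refine Finset.sum_congr rfl fun m _ => ?_
    ring_nf
  rw [this]
  refine abs_sum_le_of_abs_sub_ite_le (by simp) _ _ fun n hn => ?_
  split_ifs with h0
  · subst h0; simp [ht.le]
  · rw [sub_zero]
    exact abs_sum_cos_le ht (h n (by simpa [Nat.lt_succ_iff] using hn) h0) M

/-- The product-to-sum formula leaves the frequencies `a x ± b y`, and only `(0, 0)` contributes to
the main term. -/
theorem abs_sum_cosPoly_mul_cosPoly_sub_le {K : ℕ} {x y t : ℝ} (ht : 0 < t)
    (h : ∀ a b : ℕ, a ≤ K → b ≤ K → (a, b) ≠ (0, 0) →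
      t ≤ distInt (a * x + b * y) ∧ t ≤ distInt (a * x - b * y)) (u v : ℕ → ℝ) (M : ℕ) :
    |∑ m ∈ Finset.range M, cosPoly u K (m * x) * cosPoly v K (m * y) - M * (u 0 * v 0)|
      ≤ 1 / (2 * t) * ((∑ n ∈ Finset.range (K + 1), |u n|) *
        ∑ n ∈ Finset.range (K + 1), |v n|) := by
  have e1 : ∑ m ∈ Finset.range M, cosPoly u K (m * x) * cosPoly v K (m * y) =
      ∑ p ∈ Finset.range (K + 1) ×ˢ Finset.range (K + 1), u p.1 * v p.2 *
        ((∑ m ∈ Finset.range M, Real.cos (2 * Real.pi * (m * (p.1 * x + p.2 * y))) +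
        ∑ m ∈ Finset.range M, Real.cos (2 * Real.pi * (m * (p.1 * x - p.2 * y)))) / 2) := by
    have e0 : ∀ m : ℕ, cosPoly u K (m * x) * cosPoly v K (m * y) =
        ∑ p ∈ Finset.range (K + 1) ×ˢ Finset.range (K + 1),
          u p.1 * Real.cos (2 * Real.pi * p.1 * (m * x)) *
            (v p.2 * Real.cos (2 * Real.pi * p.2 * (m * y))) := by
      intro m
      rw [cosPoly, cosPoly, Finset.sum_mul_sum, ← Finset.sum_product']
    rw [Finset.sum_congr rfl fun m _ => e0 m, Finset.sum_comm]
    refine Finset.sum_congr rfl fun p _ => ?_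
    rw [← Finset.sum_add_distrib, Finset.sum_div, Finset.mul_sum]
    refine Finset.sum_congr rfl fun m _ => ?_
    have a1 : 2 * Real.pi * (m * (p.1 * x + p.2 * y)) =
      2 * Real.pi * p.1 * (m * x) + 2 * Real.pi * p.2 * (m * y) := by ring
    have a2 : 2 * Real.pi * (m * (p.1 * x - p.2 * y)) =
      2 * Real.pi * p.1 * (m * x) - 2 * Real.pi * p.2 * (m * y) := by ring
    rw [a1, a2, Real.cos_add, Real.cos_sub]
    ring
  have e2 : (∑ n ∈ Finset.range (K + 1), |u n|) * ∑ n ∈ Finset.range (K + 1), |v n| =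
      ∑ p ∈ Finset.range (K + 1) ×ˢ Finset.range (K + 1), |u p.1 * v p.2| := by
    rw [Finset.sum_mul_sum, ← Finset.sum_product']
    simp only [abs_mul]
  rw [e1, e2]
  refine abs_sum_le_of_abs_sub_ite_le (i₀ := ((0, 0) : ℕ × ℕ)) (by simp)
    (fun p => u p.1 * v p.2) _ fun p hp => ?_
  split_ifs with h0
  · subst h0; simp [ht.le]
  · rw [sub_zero]
    simp only [Finset.mem_product, Finset.mem_range, Nat.lt_succ_iff] at hp
    obtain ⟨b1, b2⟩ := h p.1 p.2 hp.1 hp.2 h0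
    have c1 := abs_sum_cos_le ht b1 M
    have c2 := abs_sum_cos_le ht b2 M
    rw [abs_le] at c1 c2 ⊢
    constructor <;> linarith [c1.1, c1.2, c2.1, c2.2]

/-! ### Counting the separating integers -/

theorem triangle_nonneg (h x : ℝ) : 0 ≤ triangle h x := le_max_left _ _

theorem triangle_le {h : ℝ} (h0 : 0 ≤ h) (x : ℝ) : triangle h x ≤ h :=
  max_le h0 (by linarith [distInt_nonneg x])

/-- The weight of the orbit point `m` in the lower bound for the number of separating `m`. -/
theorem mul_one_sub_sum_le_indicator {n : ℕ} {α : ℝ} {l : Fin n → ℝ} {k : Fin n} {f g : ℝ → ℝ}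
    (f0 : ∀ x, 0 ≤ f x) (f1 : ∀ x, f x ≤ 1) (fs : ∀ x, 0 < f x → distInt x ≤ 1 / (α * n))
    (g0 : ∀ x, 0 ≤ g x) (gs : ∀ x, distInt x ≤ 1 / (4 * n) → g x = 1) (hn : 2 ≤ n) (m : ℕ)
    [Decidable (Separates α l k m)] :
    f (m * l k) * (1 - ∑ j ∈ Finset.univ.erase k, g (m * l j)) ≤
      if Separates α l k m then 1 else 0 := by
  have hle : ∑ j ∈ Finset.univ.erase k, g (m * l j) < 1 → Separates α l k m ∨ f (m * l k) = 0 := by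
    intro hlt
    have hd : ∀ j, j ≠ k → ¬ distInt (m * l j) ≤ 1 / (4 * n) := by
      intro j hj hd
      have := Finset.single_le_sum (f := fun j => g (m * l j)) (fun i _ => g0 _)
        (Finset.mem_erase.mpr ⟨hj, Finset.mem_univ j⟩)
      rw [gs _ hd] at this
      linarith
    rcases (f0 (m * l k)).eq_or_lt with h | h
    · exact Or.inr h.symm
    refine Or.inl ⟨?_, fract_mem_bIn (fs _ h), fun j hj hb =>
      hd j hj (distInt_le_of_fract_mem_bOut hb)⟩
    -- The value `m = 0` puts every `m l j` at the centre of the outer arc, so a second index rules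
    -- it out.
    rcases Nat.eq_zero_or_pos m with rfl | h
    · have : Nontrivial (Fin n) := Fin.nontrivial_iff_two_le.mpr hn
      obtain ⟨j, hj⟩ := exists_ne k
      refine absurd ?_ (hd j hj)
      simp [distInt]
    · exact h
  have hs : 0 ≤ ∑ j ∈ Finset.univ.erase k, g (m * l j) := Finset.sum_nonneg fun _ _ => g0 _
  split_ifs with h
  · nlinarith [f0 (m * l k), f1 (m * l k)]
  · rcases lt_or_ge (∑ j ∈ Finset.univ.erase k, g (m * l j)) 1 with h1 | h1
    · rcases hle h1 with h2 | h2
      · exact absurd h2 h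
      · rw [h2, zero_mul]
    · nlinarith [f0 (m * l k)]

/-- Replacing `f` and `g` by trigonometric polynomials leaves one single sum and `n - 1` pair sums,
each equal to `M` times its zero-frequency term up to the exponential-sum error. -/
theorem sum_mul_one_sub_sum_ge {n K : ℕ} {l : Fin n → ℝ} {k : Fin n} {f g : ℝ → ℝ} {u v : ℕ → ℝ}
    {t U V ε η : ℝ} (f1 : ∀ x, |f x| ≤ 1) (g1 : ∀ x, |g x| ≤ 1)
    (fu : ∀ x, |f x - cosPoly u K x| ≤ ε) (gv : ∀ x, |g x - cosPoly v K x| ≤ η) (hε : ε ≤ 1)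
    (hU : ∑ i ∈ Finset.range (K + 1), |u i| ≤ U) (hV : ∑ i ∈ Finset.range (K + 1), |v i| ≤ V)
    (ht : 0 < t) (hl : ∀ j, j ≠ k → ∀ a b : ℤ, |a| ≤ K → |b| ≤ K → (a, b) ≠ (0, 0) →
      t ≤ distInt (a * l k + b * l j)) (hn : 2 ≤ n) (M : ℕ) :
    M * (u 0 * (1 - (n - 1) * v 0) - (ε + (n - 1) * (ε + 2 * η)))
        - 1 / (2 * t) * (U * (1 + (n - 1) * V)) ≤
      ∑ m ∈ Finset.range M, f (m * l k) * (1 - ∑ j ∈ Finset.univ.erase k, g (m * l j)) := by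
  have hU0 : 0 ≤ U := le_trans (Finset.sum_nonneg fun _ _ => abs_nonneg _) hU
  have hT : 0 < 1 / (2 * t) := by positivity
  have hη : 0 ≤ η := (abs_nonneg _).trans (gv 0)
  have h1 : M * (u 0 - ε) - 1 / (2 * t) * U ≤ ∑ m ∈ Finset.range M, f (m * l k) := by
    have : Nontrivial (Fin n) := Fin.nontrivial_iff_two_le.mpr hn
    obtain ⟨j, hj⟩ := exists_ne k
    have := abs_sum_cosPoly_sub_le ht (x := l k) (K := K) (fun a ha h0 => by
      simpa using hl j hj a 0 (by simpa using ha) (by simp) (by simpa using h0)) u M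
    have h2 : ∑ m ∈ Finset.range M, (cosPoly u K (m * l k) - ε) ≤
        ∑ m ∈ Finset.range M, f (m * l k) :=
      Finset.sum_le_sum fun m _ => by linarith [(abs_le.mp (fu (m * l k))).1]
    rw [Finset.sum_sub_distrib] at h2
    simp only [Finset.sum_const, Finset.card_range, nsmul_eq_mul] at h2
    have h3 : 1 / (2 * t) * ∑ n ∈ Finset.range (K + 1), |u n| ≤ 1 / (2 * t) * U :=
      mul_le_mul_of_nonneg_left hU hT.le
    linarith [(abs_le.mp this).1]
  have h2 : ∀ j ∈ Finset.univ.erase k, ∑ m ∈ Finset.range M, f (m * l k) * g (m * l j) ≤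
      M * (u 0 * v 0 + (ε + 2 * η)) + 1 / (2 * t) * (U * V) := by
    intro j hj
    have hjk := Finset.ne_of_mem_erase hj
    have := abs_sum_cosPoly_mul_cosPoly_sub_le ht (x := l k) (y := l j) (K := K)
      (fun a b ha hb h0 => ⟨by
        simpa using hl j hjk a b (by simpa using ha) (by simpa using hb) (by simpa using h0), by
        simpa [← sub_eq_add_neg] using
          hl j hjk a (-b) (by simpa using ha) (by simpa using hb) (by simpa using h0)⟩) u v M
    have h2 : ∑ m ∈ Finset.range M, f (m * l k) * g (m * l j) ≤
        ∑ m ∈ Finset.range M, (cosPoly u K (m * l k) * cosPoly v K (m * l j) + (ε + 2 * η)) := by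
      refine Finset.sum_le_sum fun m _ => ?_
      have a1 := fu (m * l k)
      have a2 := gv (m * l j)
      have a3 := g1 (m * l j)
      have a4 := f1 (m * l k)
      set F := f (m * l k)
      set G := g (m * l j)
      set p := cosPoly u K (m * l k)
      set q := cosPoly v K (m * l j)
      -- With `F G - p q = (F - p) G + p (G - q)` and `|p| ≤ 1 + ε ≤ 2`, the replacement costs at
      -- most `ε + 2η`.
      have b1 : |(F - p) * G| ≤ ε * 1 := by rw [abs_mul]; gcongr; exact (abs_nonneg _).trans a1
      have b2 : |p| ≤ 2 := by
        have := abs_sub_abs_le_abs_sub p F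
        rw [abs_sub_comm] at a1
        linarith
      have b3 : |p * (G - q)| ≤ 2 * η := by rw [abs_mul]; gcongr
      linarith [(abs_le.mp b1).2, (abs_le.mp b3).2]
    rw [Finset.sum_add_distrib] at h2
    simp only [Finset.sum_const, Finset.card_range, nsmul_eq_mul] at h2
    have h3 : 1 / (2 * t) * ((∑ n ∈ Finset.range (K + 1), |u n|) *
        ∑ n ∈ Finset.range (K + 1), |v n|) ≤ 1 / (2 * t) * (U * V) := by gcongr
    linarith [(abs_le.mp this).2]
  have h3 := Finset.sum_le_sum h2
  rw [Finset.sum_const, Finset.card_erase_of_mem (Finset.mem_univ k), Finset.card_univ,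
    Fintype.card_fin, nsmul_eq_mul, Nat.cast_sub (by omega), Nat.cast_one, Finset.sum_comm] at h3
  simp only [mul_sub, mul_one, Finset.mul_sum, Finset.sum_sub_distrib] at h1 ⊢
  linarith

/-- The degree `n^8` makes the truncation error of order `n^(-5)`, well below `c ≥ n^(-2)`. -/
theorem truncation_error_le {n c : ℝ} (hn : 5 ≤ n) (hcn : 1 / n ^ 2 ≤ c) :
    n ^ 2 / n ^ 8 + (n - 1) * (n ^ 2 / n ^ 8 + 2 * (16 * n / n ^ 8)) ≤ 7 / 100 * c := by
  have hn0 : 0 < n := by linarith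
  set r := 1 / n with hr
  have hr0 : 0 < r := by positivity
  have hr5 : r ≤ 1 / 5 := by rw [hr]; exact one_div_le_one_div_of_le (by norm_num) hn
  have hnr : n = 1 / r := by rw [hr, one_div_one_div]
  have hcr : r ^ 2 ≤ c := by rw [hr, div_pow, one_pow]; exact hcn
  have : n ^ 2 / n ^ 8 + (n - 1) * (n ^ 2 / n ^ 8 + 2 * (16 * n / n ^ 8)) ≤
      r ^ 5 + 32 * r ^ 6 := by
    have hε : n ^ 2 / n ^ 8 = 1 / n ^ 6 := by field_simp
    have hη : 16 * n / n ^ 8 = 16 / n ^ 7 := by field_simp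
    rw [hε, hη, hnr]
    have : 1 / (1 / r) ^ 6 + (1 / r - 1) * (1 / (1 / r) ^ 6 + 2 * (16 / (1 / r) ^ 7)) =
      r ^ 5 + 32 * r ^ 6 - 32 * r ^ 7 := by field_simp; ring
    rw [this]
    linarith [pow_pos hr0 7]
  refine this.trans (le_trans ?_ (mul_le_mul_of_nonneg_left hcr (by norm_num)))
  have h3 : r ^ 3 ≤ (1 / 5) ^ 3 := by gcongr
  have h4 : r ^ 4 ≤ (1 / 5) ^ 4 := by gcongr
  have : r ^ 5 + 32 * r ^ 6 = (r ^ 3 + 32 * r ^ 4) * r ^ 2 := by ring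
  rw [this]
  gcongr
  norm_num at h3 h4
  linarith

theorem weyl_error_le {n c : ℝ} (hn : 5 ≤ n) (hcn : 1 / n ^ 2 ≤ c) :
    n ^ 2 / 2 * (1 + (n - 1) * (6 * n)) / n ^ 9 ≤ 3 / 100 * c := by
  have hn0 : 0 < n := by linarith
  set r := 1 / n with hr
  have hr0 : 0 < r := by positivity
  have hr5 : r ≤ 1 / 5 := by rw [hr]; exact one_div_le_one_div_of_le (by norm_num) hn
  have hnr : n = 1 / r := by rw [hr, one_div_one_div]
  have hcr : r ^ 2 ≤ c := by rw [hr, div_pow, one_pow]; exact hcn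
  have : n ^ 2 / 2 * (1 + (n - 1) * (6 * n)) / n ^ 9 ≤ 3 * r ^ 5 := by
    rw [hnr]
    have : (1 / r) ^ 2 / 2 * (1 + (1 / r - 1) * (6 * (1 / r))) / (1 / r) ^ 9 =
      3 * r ^ 5 - 3 * r ^ 6 + r ^ 7 / 2 := by field_simp; ring
    rw [this]
    have h7 : r ^ 7 ≤ r ^ 6 := pow_le_pow_of_le_one hr0.le (by linarith) (by norm_num)
    linarith [pow_pos hr0 6]
  refine this.trans (le_trans ?_ (mul_le_mul_of_nonneg_left hcr (by norm_num)))
  have h3 : r ^ 3 ≤ (1 / 5) ^ 3 := by gcongr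
  have : 3 * r ^ 5 = (3 * r ^ 3) * r ^ 2 := by ring
  rw [this]
  gcongr
  norm_num at h3
  linarith

-- The tent `f` has half-width `c`. The trapezoid `g`, a normalised difference of tents of
-- half-widths `3d/2` and `d`, equals 1 up to distance `d`. Both inherit Fourier bounds from
-- `triangle`.
set_option maxHeartbeats 600000 in
theorem card_separates_ge {n : ℕ} {α t : ℝ} {l : Fin n → ℝ} {k : Fin n} (hn : 5 ≤ n) (hα : 4 < α)
    (hαn : α ≤ n) (ht : 0 < t) (hl : ∀ j, j ≠ k → ∀ a b : ℤ, |a| ≤ (n ^ 8 : ℕ) → |b| ≤ (n ^ 8 : ℕ) →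
      (a, b) ≠ (0, 0) → t ≤ distInt (a * l k + b * l j)) {M : ℕ} (hM : (n : ℝ) ^ 9 / (2 * t) ≤ M)
    [DecidablePred (Separates α l k)] :
    1 / (4 * (α * n)) * M ≤ ((Finset.range M).filter (Separates α l k)).card := by
  have hn5 : (5 : ℝ) ≤ n := by exact_mod_cast hn
  have hn0 : (0 : ℝ) < n := by linarith
  set c : ℝ := 1 / (α * n) with hc
  set d : ℝ := 1 / (4 * n) with hd
  have hαn0 : 0 < α * n := by positivity
  have hc0 : 0 < c := by positivity
  have hd0 : 0 < d := by positivity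
  have hd1 : d ≤ 1 / 20 := by
    rw [hd]; exact one_div_le_one_div_of_le (by norm_num) (by linarith)
  have hcd : c ≤ d := by
    rw [hc, hd]; exact one_div_le_one_div_of_le (by positivity) (by nlinarith)
  have hcn : 1 / (n : ℝ) ^ 2 ≤ c := by
    rw [hc]; exact one_div_le_one_div_of_le (by positivity) (by nlinarith)
  have hci : 1 / c ≤ (n : ℝ) ^ 2 := by rw [hc, one_div_one_div]; nlinarith
  have hdi : 1 / d = 4 * n := by rw [hd, one_div_one_div]
  set K := n ^ 8 with hK
  have hK0 : K ≠ 0 := by positivity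
  have hKr : (K : ℝ) = (n : ℝ) ^ 8 := by rw [hK]; push_cast; rfl
  have hd2 : 3 / 2 * d ≤ 1 / 2 := by linarith
  set f : ℝ → ℝ := fun x => triangle c x / c with hf
  set g : ℝ → ℝ := fun x => (triangle (3 / 2 * d) x - triangle d x) / (d / 2) with hg
  set u : ℕ → ℝ := fun i => triangleCoeff c i / c with hu
  set v : ℕ → ℝ := fun i => (triangleCoeff (3 / 2 * d) i - triangleCoeff d i) / (d / 2) with hv
  have f0 : ∀ x, 0 ≤ f x := fun x => div_nonneg (triangle_nonneg _ _) hc0.le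
  have f1 : ∀ x, f x ≤ 1 := fun x => (div_le_one hc0).mpr (triangle_le hc0.le x)
  have fs : ∀ x, 0 < f x → distInt x ≤ c := by
    intro x hx
    have : 0 < triangle c x := by simpa [hf, hc0] using hx
    rw [triangle, lt_max_iff] at this
    rcases this with h | h <;> linarith
  have g01 : ∀ x, 0 ≤ g x ∧ g x ≤ 1 := by
    intro x
    have hx := distInt_nonneg x
    rw [hg]
    simp only [triangle]
    rw [le_div_iff₀ (by positivity), div_le_iff₀ (by positivity)]
    rcases max_cases 0 (3 / 2 * d - distInt x) with ⟨h, h'⟩ | ⟨h, h'⟩ <;>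
      rcases max_cases 0 (d - distInt x) with ⟨e, e'⟩ | ⟨e, e'⟩ <;> rw [h, e] <;>
      constructor <;> linarith
  have gs : ∀ x, distInt x ≤ d → g x = 1 := by
    intro x hx
    rw [hg]
    simp only [triangle]
    rw [max_eq_right (by linarith), max_eq_right (by linarith)]
    field_simp
    ring
  have fu : ∀ x, |f x - cosPoly u K x| ≤ (n : ℝ) ^ 2 / K := by
    intro x
    have e : f x - cosPoly u K x = (triangle c x - ∑ i ∈ Finset.range (K + 1),
        triangleCoeff c i * Real.cos (2 * Real.pi * i * x)) * (1 / c) := by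
      rw [cosPoly, sub_mul, Finset.sum_mul]
      congr 1
      · rw [hf]; ring
      · exact Finset.sum_congr rfl fun i _ => by rw [hu]; ring
    rw [e, abs_mul, abs_of_pos (by positivity : 0 < 1 / c)]
    calc _ ≤ 1 / (K : ℝ) * (n : ℝ) ^ 2 := by
          gcongr; exact abs_triangle_sub_le hc0.le (by linarith) hK0 x
      _ = _ := by ring
  have gv : ∀ x, |g x - cosPoly v K x| ≤ 16 * n / K := by
    intro x
    have e : g x - cosPoly v K x = ((triangle (3 / 2 * d) x - ∑ i ∈ Finset.range (K + 1),
        triangleCoeff (3 / 2 * d) i * Real.cos (2 * Real.pi * i * x)) -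
        (triangle d x - ∑ i ∈ Finset.range (K + 1),
        triangleCoeff d i * Real.cos (2 * Real.pi * i * x))) * (2 * (1 / d)) := by
      rw [cosPoly, sub_sub_sub_comm, ← Finset.sum_sub_distrib, sub_mul, Finset.sum_mul]
      congr 1
      · rw [hg]; field_simp
      · exact Finset.sum_congr rfl fun i _ => by rw [hv]; field_simp
    rw [e, hdi, abs_mul, abs_of_pos (by positivity : 0 < 2 * (4 * (n : ℝ)))]
    calc _ ≤ (1 / (K : ℝ) + 1 / K) * (2 * (4 * n)) := by
          gcongr
          refine (abs_sub _ _).trans (add_le_add ?_ ?_)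
          · exact abs_triangle_sub_le (by positivity) hd2 hK0 x
          · exact abs_triangle_sub_le hd0.le (by linarith) hK0 x
      _ = _ := by ring
  have hU : ∑ i ∈ Finset.range (K + 1), |u i| ≤ (n : ℝ) ^ 2 / 2 := by
    have e : ∑ i ∈ Finset.range (K + 1), |u i| =
        (∑ i ∈ Finset.range (K + 1), |triangleCoeff c i|) * (1 / c) := by
      rw [Finset.sum_mul]
      exact Finset.sum_congr rfl fun i _ => by rw [hu, abs_div, abs_of_pos hc0]; ring
    rw [e]
    calc _ ≤ (c ^ 2 + 1 / 3) * (n : ℝ) ^ 2 := by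
          gcongr; exact sum_abs_triangleCoeff_le c K
      _ ≤ (1 / 2) * (n : ℝ) ^ 2 := by gcongr; nlinarith
      _ = _ := by ring
  have hV : ∑ i ∈ Finset.range (K + 1), |v i| ≤ 6 * n := by
    calc _ ≤ ∑ i ∈ Finset.range (K + 1),
          (|triangleCoeff (3 / 2 * d) i| + |triangleCoeff d i|) * (2 * (1 / d)) := by
          refine Finset.sum_le_sum fun i _ => ?_
          rw [hv]
          simp only
          rw [abs_div, abs_of_pos (by positivity : 0 < d / 2), div_eq_mul_one_div]
          have : 1 / (d / 2) = 2 * (1 / d) := by field_simp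
          rw [this]
          gcongr
          exact abs_sub _ _
      _ ≤ (((3 / 2 * d) ^ 2 + 1 / 3) + (d ^ 2 + 1 / 3)) * (2 * (1 / d)) := by
          rw [← Finset.sum_mul, Finset.sum_add_distrib]
          gcongr
          · exact sum_abs_triangleCoeff_le _ K
          · exact sum_abs_triangleCoeff_le _ K
      _ ≤ (3 / 4) * (2 * (1 / d)) := by gcongr; nlinarith
      _ = _ := by rw [hdi]; ring
  have hε : (n : ℝ) ^ 2 / K = 1 / (n : ℝ) ^ 6 := by rw [hKr]; field_simp
  have key := sum_mul_one_sub_sum_ge (fun x => abs_le.mpr ⟨by linarith [f0 x], f1 x⟩)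
    (fun x => abs_le.mpr ⟨by linarith [(g01 x).1], (g01 x).2⟩) fu gv
    (by rw [hε]; exact (div_le_one (by positivity)).mpr (one_le_pow₀ (by linarith)))
    hU hV ht hl (by omega) M
  have hu0 : u 0 = c := by simp [hu, triangleCoeff]; field_simp
  have hv0 : v 0 = 5 / 2 * d := by simp [hv, triangleCoeff]; field_simp; ring
  have hcard : ∑ m ∈ Finset.range M, f (m * l k) * (1 - ∑ j ∈ Finset.univ.erase k, g (m * l j)) ≤
      ((Finset.range M).filter (Separates α l k)).card := by
    rw [Finset.card_filter]
    push_cast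
    exact Finset.sum_le_sum fun m _ =>
      mul_one_sub_sum_le_indicator f0 f1 fs (fun x => (g01 x).1) gs (by omega) m
  refine le_trans ?_ (key.trans hcard)
  have hT : 1 / (2 * t) ≤ M / (n : ℝ) ^ 9 := by
    rw [le_div_iff₀ (by positivity)]
    calc _ = (n : ℝ) ^ 9 / (2 * t) := by ring
      _ ≤ M := hM
  -- The mean of `g` is `5d/2` and `n d = 1/4`, so the `n - 1` outer conditions cost at most `5/8`.
  have hmain : 3 / 8 * c ≤ u 0 * (1 - (n - 1) * v 0) := by
    rw [hu0, hv0]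
    have : (n : ℝ) * d = 1 / 4 := by rw [hd]; field_simp
    nlinarith
  have htrunc := truncation_error_le hn5 hcn
  have hweyl := weyl_error_le hn5 hcn
  rw [← hKr] at htrunc
  have hM0 : (0 : ℝ) ≤ M := Nat.cast_nonneg M
  have hw : 1 / (2 * t) * ((n : ℝ) ^ 2 / 2 * (1 + (n - 1) * (6 * n))) ≤ M * (3 / 100 * c) := by
    calc _ ≤ M / (n : ℝ) ^ 9 * ((n : ℝ) ^ 2 / 2 * (1 + (n - 1) * (6 * n))) := by
          apply mul_le_mul_of_nonneg_right hT
          have : 0 ≤ ((n : ℝ) - 1) * (6 * n) := by nlinarith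
          positivity
      _ = M * ((n : ℝ) ^ 2 / 2 * (1 + (n - 1) * (6 * n)) / (n : ℝ) ^ 9) := by ring
      _ ≤ _ := mul_le_mul_of_nonneg_left hweyl hM0
  have hfin : 1 / (4 * (α * n)) = c / 4 := by rw [hc]; field_simp
  rw [hfin]
  set X := u 0 * (1 - (n - 1) * v 0) -
    ((n : ℝ) ^ 2 / K + (n - 1) * ((n : ℝ) ^ 2 / K + 2 * (16 * n / K)))
  -- `3/8 - 7/100 - 3/100 = 11/40`, which exceeds the required `1/4`.
  have hX : M * (11 / 40 * c) ≤ M * (X - 3 / 100 * c) :=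
    mul_le_mul_of_nonneg_left (by linarith) hM0
  have hMc := mul_nonneg hM0 hc0.le
  rw [mul_sub] at hX
  linarith

/-! ### Perturbation of simple eigenvalues -/

theorem exists_abs_sub_le_of_weighted_sum {ι : Type*} [Fintype ι] {w l : ι → ℝ} {μ ρ : ℝ}
    (w0 : ∀ i, 0 ≤ w i) (w1 : ∑ i, w i = 1) (hρ : 0 ≤ ρ)
    (h : ∑ i, w i * (l i - μ) ^ 2 ≤ ρ ^ 2) : ∃ i, |l i - μ| ≤ ρ := by
  by_contra! hc
  have h1 : ∑ i, w i * ρ ^ 2 < ∑ i, w i * (l i - μ) ^ 2 := by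
    have hsq : ∀ i, ρ ^ 2 < (l i - μ) ^ 2 := fun i => by
      rw [← sq_abs (l i - μ)]; exact pow_lt_pow_left₀ (hc i) hρ two_ne_zero
    obtain ⟨i, -, hi⟩ : ∃ i ∈ Finset.univ, 0 < w i := by
      by_contra! hn
      linarith [Finset.sum_nonpos hn]
    exact Finset.sum_lt_sum (fun j _ => mul_le_mul_of_nonneg_left (hsq j).le (w0 j))
      ⟨i, Finset.mem_univ i, mul_lt_mul_of_pos_left (hsq i) hi⟩
  rw [← Finset.sum_mul, w1, one_mul] at h1
  linarith

/-- The Kato-Temple inequality for a discrete probability distribution. -/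
theorem abs_sub_le_of_weighted_sum {ι : Type*} [Fintype ι] [DecidableEq ι] {w l : ι → ℝ}
    {μ r γ : ℝ} {k : ι} (w0 : ∀ i, 0 ≤ w i) (w1 : ∑ i, w i = 1)
    (hmean : ∑ i, w i * (l i - μ) = 0) (h : ∑ i, w i * (l i - μ) ^ 2 ≤ r ^ 2) (hγ : 0 < γ)
    (hk : ∀ i, i ≠ k → γ ≤ |l i - μ|) (hr : 2 * r ^ 2 ≤ γ ^ 2) : |l k - μ| ≤ 2 * r ^ 2 / γ := by
  have hle : ∑ i ∈ Finset.univ.erase k, w i * (l i - μ) ^ 2 ≤ r ^ 2 :=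
    (Finset.sum_le_sum_of_subset_of_nonneg (Finset.erase_subset _ _)
      fun i _ _ => mul_nonneg (w0 i) (sq_nonneg _)).trans h
  -- Chebyshev: the mass away from `k` is at most `r² / γ² ≤ 1/2`.
  have h1 : γ ^ 2 * (1 - w k) ≤ r ^ 2 := by
    rw [← w1, ← Finset.add_sum_erase _ _ (Finset.mem_univ k), add_sub_cancel_left,
      Finset.mul_sum]
    refine le_trans (Finset.sum_le_sum fun i hi => ?_) hle
    rw [mul_comm, ← sq_abs (l i - μ)]
    have := hk i (Finset.ne_of_mem_erase hi)
    have := w0 i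
    gcongr
  -- The mean is `μ`, so the deviation at `k` balances the others, where `γ |l i - μ| ≤ (l i - μ)²`.
  have h2 : γ * (w k * |l k - μ|) ≤ r ^ 2 := by
    have e : w k * |l k - μ| = |∑ i ∈ Finset.univ.erase k, w i * (l i - μ)| := by
      rw [← Finset.add_sum_erase _ _ (Finset.mem_univ k)] at hmean
      rw [← abs_of_nonneg (w0 k), ← abs_mul, eq_neg_of_add_eq_zero_left hmean, abs_neg]
    rw [e]
    refine (mul_le_mul_of_nonneg_left (Finset.abs_sum_le_sum_abs _ _) hγ.le).trans ?_
    rw [Finset.mul_sum]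
    refine le_trans (Finset.sum_le_sum fun i hi => ?_) hle
    have := hk i (Finset.ne_of_mem_erase hi)
    rw [abs_mul, abs_of_nonneg (w0 i), ← sq_abs (l i - μ)]
    nlinarith [mul_nonneg (w0 i) (mul_nonneg (abs_nonneg (l i - μ)) (sub_nonneg.mpr this))]
  have h3 : 1 / 2 ≤ w k := by
    have : 0 < γ ^ 2 := by positivity
    by_contra! hc
    nlinarith
  rw [le_div_iff₀ hγ]
  nlinarith [mul_nonneg (mul_nonneg hγ.le (abs_nonneg (l k - μ))) (sub_nonneg.mpr h3)]

/-- The gap makes any choice of nearby indices strictly increasing, and a strictly increasing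
self-map of `Fin n` is the identity. No min-max principle is needed. -/
theorem abs_sub_le_of_antitone_of_gap {n : ℕ} {d l : Fin n → ℝ} (hl : Antitone l) {δ ρ : ℝ}
    (hd : ∀ i j, i < j → δ ≤ d i - d j) (hρ : 2 * ρ < δ) (h : ∀ k, ∃ i, |l i - d k| ≤ ρ)
    (k : Fin n) : |l k - d k| ≤ ρ := by
  choose f hf using h
  have hmono : StrictMono f := by
    intro i j hij
    by_contra! hc
    have h1 := hl hc
    have h2 := abs_le.mp (hf i)
    have h3 := abs_le.mp (hf j)
    linarith [hd i j hij, h2.1, h3.2]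
  have hid : f = id := (StrictMono.range_inj hmono strictMono_id).mp (by
    rw [Set.range_id, (Finite.surjective_of_injective hmono.injective).range_eq])
  simpa [hid] using hf k

section Operator

variable {E : Type*} [NormedAddCommGroup E] [InnerProductSpace ℂ E] {ι : Type*} [Fintype ι]
  {T : E →ₗ[ℂ] E} {b : OrthonormalBasis ι ℂ E} {l : ι → ℝ}

theorem inner_apply_of_eigenbasis (hT : T.IsSymmetric) (hb : ∀ i, T (b i) = (l i : ℂ) • b i)
    (x : E) (i : ι) : inner ℂ (b i) (T x) = l i * inner ℂ (b i) x := by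
  rw [← hT, hb, inner_smul_left, Complex.conj_ofReal]

/-- The weights `‖⟨b i, x⟩‖²` form the spectral measure of `x`: its second moment about `μ` is the
squared residual, and for a unit vector its mean is the Rayleigh quotient. -/
theorem sum_norm_sq_mul_sq (hT : T.IsSymmetric) (hb : ∀ i, T (b i) = (l i : ℂ) • b i)
    (x : E) (μ : ℝ) :
    ∑ i, ‖inner ℂ (b i) x‖ ^ 2 * (l i - μ) ^ 2 = ‖T x - (μ : ℂ) • x‖ ^ 2 := by
  rw [← b.sum_sq_norm_inner_right]
  refine Finset.sum_congr rfl fun i _ => ?_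
  rw [inner_sub_right, inner_apply_of_eigenbasis hT hb, inner_smul_right, ← sub_mul,
    ← Complex.ofReal_sub, norm_mul, mul_pow, Complex.norm_real, Real.norm_eq_abs, sq_abs, mul_comm]

theorem sum_norm_sq_mul_sub (hT : T.IsSymmetric) (hb : ∀ i, T (b i) = (l i : ℂ) • b i)
    {x : E} (hx : ‖x‖ = 1) (μ : ℝ) :
    ∑ i, ‖inner ℂ (b i) x‖ ^ 2 * (l i - μ) = (inner ℂ x (T x)).re - μ := by
  have h1 : ∑ i, ‖inner ℂ (b i) x‖ ^ 2 = 1 := by rw [b.sum_sq_norm_inner_right, hx, one_pow]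
  have h2 : inner ℂ x (T x) = ∑ i, ((‖inner ℂ (b i) x‖ ^ 2 * l i : ℝ) : ℂ) := by
    rw [← b.sum_inner_mul_inner]
    refine Finset.sum_congr rfl fun i _ => ?_
    rw [inner_apply_of_eigenbasis hT hb, ← inner_conj_symm x (b i)]
    push_cast
    rw [← Complex.conj_mul']
    ring
  simp only [mul_sub, Finset.sum_sub_distrib, ← Finset.sum_mul, h1, one_mul]
  rw [h2, ← Complex.ofReal_sum, Complex.ofReal_re]

end Operator

theorem exists_orthonormalBasis_sortedEigenvalues {n : ℕ} {A : Matrix (Fin n) (Fin n) ℂ}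
    (hA : A.IsHermitian) : ∃ b : OrthonormalBasis (Fin n) ℂ (EuclideanSpace ℂ (Fin n)),
      ∀ i, Matrix.toEuclideanLin A (b i) = (sortedEigenvalues hA i : ℂ) • b i := by
  refine ⟨((Matrix.isSymmetric_toEuclideanLin_iff.mpr hA).eigenvectorBasis
    finrank_euclideanSpace).reindex (finCongr (Fintype.card_fin n)), fun i => ?_⟩
  rw [OrthonormalBasis.reindex_apply, LinearMap.IsSymmetric.apply_eigenvectorBasis]
  rfl

/-- The square of the Frobenius norm. -/
noncomputable def frobeniusSq {n : ℕ} (A : Matrix (Fin n) (Fin n) ℂ) : ℝ := ∑ i, ∑ j, ‖A i j‖ ^ 2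

theorem norm_toEuclideanLin_sq_le {n : ℕ} (A : Matrix (Fin n) (Fin n) ℂ)
    (x : EuclideanSpace ℂ (Fin n)) :
    ‖Matrix.toEuclideanLin A x‖ ^ 2 ≤ frobeniusSq A * ‖x‖ ^ 2 := by
  rw [EuclideanSpace.norm_sq_eq, EuclideanSpace.norm_sq_eq, frobeniusSq, Finset.sum_mul]
  refine Finset.sum_le_sum fun i _ => ?_
  have h1 : ‖Matrix.toEuclideanLin A x i‖ ≤ ∑ j, ‖A i j‖ * ‖x j‖ := by
    have : Matrix.toEuclideanLin A x i = ∑ j, A i j * x j := rfl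
    rw [this]
    exact (norm_sum_le _ _).trans (Finset.sum_le_sum fun j _ => norm_mul_le _ _)
  exact (pow_le_pow_left₀ (norm_nonneg _) h1 2).trans (Finset.sum_mul_sq_le_sq_mul_sq _ _ _)

theorem norm_toEuclideanLin_le {n : ℕ} {A : Matrix (Fin n) (Fin n) ℂ} {ρ : ℝ} (hρ : 0 ≤ ρ)
    (hA : frobeniusSq A ≤ ρ ^ 2) {x : EuclideanSpace ℂ (Fin n)} (hx : ‖x‖ = 1) :
    ‖Matrix.toEuclideanLin A x‖ ≤ ρ := by
  have := norm_toEuclideanLin_sq_le A x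
  rw [hx, one_pow, mul_one] at this
  exact abs_le_of_sq_le_sq' (this.trans hA) hρ |>.2

/-- An eigenvector of `A` is an approximate eigenvector of `B` with residual at most `ρ`; the gap
then matches the indices. -/
theorem abs_sortedEigenvalues_sub_le {n : ℕ} {A B : Matrix (Fin n) (Fin n) ℂ} {δ ρ : ℝ}
    (hA : A.IsHermitian) (hB : B.IsHermitian)
    (hd : ∀ i j, i < j → δ ≤ sortedEigenvalues hA i - sortedEigenvalues hA j)
    (hρ0 : 0 ≤ ρ) (hρ : 2 * ρ < δ) (hAB : frobeniusSq (B - A) ≤ ρ ^ 2) (k : Fin n) :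
    |sortedEigenvalues hB k - sortedEigenvalues hA k| ≤ ρ := by
  obtain ⟨a, ha⟩ := exists_orthonormalBasis_sortedEigenvalues hA
  obtain ⟨b, hb⟩ := exists_orthonormalBasis_sortedEigenvalues hB
  refine abs_sub_le_of_antitone_of_gap (sortedEigenvalues_antitone hB) hd hρ (fun k => ?_) k
  have hx := a.norm_eq_one k
  refine exists_abs_sub_le_of_weighted_sum (w := fun i => ‖inner ℂ (b i) (a k)‖ ^ 2)
    (fun i => sq_nonneg _) (by rw [b.sum_sq_norm_inner_right, hx, one_pow]) hρ0 ?_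
  rw [sum_norm_sq_mul_sq (Matrix.isSymmetric_toEuclideanLin_iff.mpr hB) hb]
  have : Matrix.toEuclideanLin B (a k) - (sortedEigenvalues hA k : ℂ) • a k =
      Matrix.toEuclideanLin (B - A) (a k) := by
    rw [map_sub, LinearMap.sub_apply, ha]
  rw [this]
  exact pow_le_pow_left₀ (norm_nonneg _) (norm_toEuclideanLin_le hρ0 hAB hx) 2

/-- The real part of the quadratic form of `A` at `x`. -/
noncomputable def quadForm {n : ℕ} (A : Matrix (Fin n) (Fin n) ℂ)
    (x : EuclideanSpace ℂ (Fin n)) : ℝ :=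
  (inner ℂ x (Matrix.toEuclideanLin A x)).re

theorem frobeniusSq_smul {n : ℕ} (z : ℝ) (A : Matrix (Fin n) (Fin n) ℂ) :
    frobeniusSq ((z : ℂ) • A) = z ^ 2 * frobeniusSq A := by
  simp [frobeniusSq, mul_pow, Finset.mul_sum]

theorem abs_quadForm_le {n : ℕ} {A : Matrix (Fin n) (Fin n) ℂ} {ρ : ℝ} (hρ : 0 ≤ ρ)
    (hA : frobeniusSq A ≤ ρ ^ 2) {x : EuclideanSpace ℂ (Fin n)} (hx : ‖x‖ = 1) :
    |quadForm A x| ≤ ρ := by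
  refine (Complex.abs_re_le_norm _).trans ((norm_inner_le_norm _ _).trans ?_)
  rw [hx, one_mul]
  exact norm_toEuclideanLin_le hρ hA hx

theorem isHermitian_add_smul {n : ℕ} {A G : Matrix (Fin n) (Fin n) ℂ} (hA : A.IsHermitian)
    (hG : G.IsHermitian) (z : ℝ) : (A + (z : ℂ) • G).IsHermitian := by
  refine hA.add ?_
  rw [Matrix.IsHermitian, Matrix.conjTranspose_smul, hG.eq]
  simp

/-- First-order perturbation theory of a simple eigenvalue, with an explicit error. -/
theorem abs_sortedEigenvalues_add_smul_sub_le {n : ℕ} {A G : Matrix (Fin n) (Fin n) ℂ}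
    {δ z R : ℝ} (hA : A.IsHermitian) (hG : G.IsHermitian)
    (hd : ∀ i j, i < j → δ ≤ sortedEigenvalues hA i - sortedEigenvalues hA j) (hδ : 0 < δ)
    (hz : 0 ≤ z) (hR : 0 ≤ R) (hzR : 6 * (z * R) ≤ δ) (hGR : frobeniusSq G ≤ R ^ 2)
    {a : OrthonormalBasis (Fin n) ℂ (EuclideanSpace ℂ (Fin n))}
    (ha : ∀ i, Matrix.toEuclideanLin A (a i) = (sortedEigenvalues hA i : ℂ) • a i) (k : Fin n) :
    |sortedEigenvalues (isHermitian_add_smul hA hG z) k -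
      (sortedEigenvalues hA k + z * quadForm G (a k))| ≤ 16 * (z * R) ^ 2 / δ := by
  have hB := isHermitian_add_smul hA hG z
  obtain ⟨b, hb⟩ := exists_orthonormalBasis_sortedEigenvalues hB
  have hzR0 : 0 ≤ z * R := mul_nonneg hz hR
  have hx := a.norm_eq_one k
  have hq := abs_quadForm_le hR hGR hx
  set s := quadForm G (a k) with hs
  set μ := sortedEigenvalues hA k + z * s with hμ
  have hzs : |z * s| ≤ z * R := by rw [abs_mul, abs_of_nonneg hz]; gcongr
  have hsym := Matrix.isSymmetric_toEuclideanLin_iff.mpr hB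
  have happ : Matrix.toEuclideanLin (A + (z : ℂ) • G) (a k) =
      (sortedEigenvalues hA k : ℂ) • a k + (z : ℂ) • Matrix.toEuclideanLin G (a k) := by
    rw [map_add, map_smul, LinearMap.add_apply, LinearMap.smul_apply, ha]
  have hcrude : ∀ i, |sortedEigenvalues hB i - sortedEigenvalues hA i| ≤ z * R := by
    refine fun i => abs_sortedEigenvalues_sub_le hA hB hd hzR0 (by linarith) ?_ i
    rw [add_sub_cancel_left, frobeniusSq_smul, mul_pow]
    gcongr
  -- Here `μ` is the Rayleigh quotient of `a k`, so the mean vanishes; the residual is at most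
  -- `2zR`, and the other eigenvalues stay at distance at least `δ - 2zR ≥ δ/2`.
  have key := abs_sub_le_of_weighted_sum (w := fun i => ‖inner ℂ (b i) (a k)‖ ^ 2)
    (l := sortedEigenvalues hB) (μ := μ) (r := 2 * (z * R)) (γ := δ / 2) (k := k)
    (fun i => sq_nonneg _) (by rw [b.sum_sq_norm_inner_right, hx, one_pow]) ?_ ?_ (by positivity)
    ?_ ?_
  · refine key.trans (le_of_eq ?_)
    field_simp
    ring
  · rw [sum_norm_sq_mul_sub hsym hb hx, happ, inner_add_right, inner_smul_right, inner_smul_right,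
      inner_self_eq_norm_sq_to_K, hx, hμ, hs, quadForm]
    simp
  · rw [sum_norm_sq_mul_sq hsym hb, happ]
    refine pow_le_pow_left₀ (norm_nonneg _) ?_ 2
    have e : (sortedEigenvalues hA k : ℂ) • a k + (z : ℂ) • Matrix.toEuclideanLin G (a k) -
        (μ : ℂ) • a k = (z : ℂ) • Matrix.toEuclideanLin G (a k) - ((z * s : ℝ) : ℂ) • a k := by
      rw [hμ]; push_cast; rw [add_smul]; abel
    rw [e]
    refine (norm_sub_le _ _).trans ?_
    rw [norm_smul, norm_smul, hx, Complex.norm_real, Complex.norm_real, Real.norm_eq_abs,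
      Real.norm_eq_abs, abs_of_nonneg hz, mul_one]
    have := mul_le_mul_of_nonneg_left (norm_toEuclideanLin_le hR hGR hx) hz
    linarith
  · intro i hi
    have h1 := hcrude i
    have h2 : δ ≤ |sortedEigenvalues hA i - sortedEigenvalues hA k| := by
      rcases lt_or_gt_of_ne hi with h | h
      · exact (hd i k h).trans (le_abs_self _)
      · rw [abs_sub_comm]; exact (hd k i h).trans (le_abs_self _)
    have h3 : sortedEigenvalues hA i - sortedEigenvalues hA k =
      (sortedEigenvalues hB i - μ) - (sortedEigenvalues hB i - sortedEigenvalues hA i) + z * s := by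
      rw [hμ]; ring
    have h4 := abs_add_le ((sortedEigenvalues hB i - μ) -
      (sortedEigenvalues hB i - sortedEigenvalues hA i)) (z * s)
    have h5 := abs_sub (sortedEigenvalues hB i - μ)
      (sortedEigenvalues hB i - sortedEigenvalues hA i)
    rw [h3] at h2
    linarith
  · nlinarith

theorem IsSeparatedMatrix.le_sub {n : ℕ} {δ : ℝ} {A : Matrix (Fin n) (Fin n) ℂ}
    (hA : IsSeparatedMatrix δ A) (i j : Fin n) (hij : i < j) :
    δ ≤ sortedEigenvalues hA.posSemidef.isHermitian i -
      sortedEigenvalues hA.posSemidef.isHermitian j := by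
  have hi : (i : ℕ) + 1 < n := by have := j.2; have : (i : ℕ) < j := hij; omega
  have h1 := hA.gap i ⟨i + 1, hi⟩ rfl
  have h2 := sortedEigenvalues_antitone hA.posSemidef.isHermitian
    (show (⟨i + 1, hi⟩ : Fin n) ≤ j from hij)
  linarith

/-! ### Gaussian functionals and anti-concentration for the GUE -/

theorem map_sum_eq_gaussianReal {Ω ι : Type*} [MeasurableSpace Ω] {P : Measure Ω}
    [IsProbabilityMeasure P] {X : ι → Ω → ℝ} {v : ι → NNReal} (hX : iIndepFun X P)
    (hm : ∀ i, Measurable (X i)) (hv : ∀ i, P.map (X i) = gaussianReal 0 (v i)) (s : Finset ι) :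
    P.map (∑ i ∈ s, X i) = gaussianReal 0 (∑ i ∈ s, v i) := by
  classical
  induction s using Finset.induction_on with
  | empty =>
    simp only [Finset.sum_empty, gaussianReal_zero_var]
    have : (0 : Ω → ℝ) = fun _ => 0 := rfl
    rw [this, Measure.map_const]
    simp
  | insert i s hi ih =>
    rw [Finset.sum_insert hi, Finset.sum_insert hi]
    simpa using gaussianReal_add_gaussianReal_of_indepFun
      (hX.indepFun_finsetSum_of_notMem hm hi).symm (hv i) ih

/-- The standard Gaussian measure on real arrays. -/
noncomputable abbrev gaussianArray (n : ℕ) : Measure (Fin n → Fin n → ℝ) :=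
  Measure.pi fun _ : Fin n => Measure.pi fun _ : Fin n => gaussianReal 0 1

theorem map_linear_gaussianReal {ι : Type*} [Fintype ι] (c : ι → ℝ) :
    (Measure.pi fun _ : ι => gaussianReal 0 1).map (fun g => ∑ i, c i * g i) =
      gaussianReal 0 (∑ i, NNReal.mk (c i ^ 2) (sq_nonneg _)) := by
  have hi : iIndepFun (fun i (g : ι → ℝ) => c i * g i)
      (Measure.pi fun _ : ι => gaussianReal 0 1) :=
    iIndepFun_pi (μ := fun _ : ι => gaussianReal 0 1) (X := fun i x => c i * x)
      fun i => by fun_prop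
  have := map_sum_eq_gaussianReal hi (fun i => by fun_prop)
    (v := fun i => NNReal.mk (c i ^ 2) (sq_nonneg _)) (fun i => ?_) Finset.univ
  · convert this using 2
    ext g
    simp
  · have h := (measurePreserving_eval (fun _ : ι => gaussianReal 0 1) i).map_eq
    have h2 := gaussianReal_map_const_mul (μ := 0) (v := 1) (c i)
    rw [← h, Measure.map_map (by fun_prop) (by fun_prop)] at h2
    simp only [mul_zero, mul_one] at h2
    exact h2

theorem map_linear_gaussianArray {n : ℕ} (c : Fin n → Fin n → ℝ) :
    (gaussianArray n).map (fun g => ∑ i, ∑ j, c i j * g i j) =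
      gaussianReal 0 (∑ i, ∑ j, NNReal.mk (c i j ^ 2) (sq_nonneg _)) := by
  have hi : iIndepFun (fun i (g : Fin n → Fin n → ℝ) => ∑ j, c i j * g i j) (gaussianArray n) :=
    iIndepFun_pi (μ := fun _ : Fin n => Measure.pi fun _ : Fin n => gaussianReal 0 1)
      (X := fun i x => ∑ j, c i j * x j) fun i =>
        (by fun_prop : Measurable fun x : Fin n → ℝ => ∑ j, c i j * x j).aemeasurable
  have := map_sum_eq_gaussianReal hi (fun i => by fun_prop)
    (v := fun i => ∑ j, NNReal.mk (c i j ^ 2) (sq_nonneg _)) (fun i => ?_) Finset.univ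
  · convert this using 2
    ext g
    simp
  · have h := (measurePreserving_eval
      (fun _ : Fin n => Measure.pi fun _ : Fin n => gaussianReal 0 1) i).map_eq
    have h2 := map_linear_gaussianReal (c i)
    rw [← h, Measure.map_map (by fun_prop) (by fun_prop)] at h2
    exact h2

/-- For variance at least 1 the density is at most `1/√(2π) ≤ 1/2`, and the interval has length
`2r`. -/
theorem gaussianReal_abs_sub_lt_le {v : NNReal} (hv : 1 ≤ v) (s r : ℝ) :
    gaussianReal 0 v {y | |y - s| < r} ≤ ENNReal.ofReal r := by
  have hv0 : v ≠ 0 := (zero_lt_one.trans_le hv).ne'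
  have hball : {y : ℝ | |y - s| < r} = Metric.ball s r := by
    ext y; simp [Real.dist_eq]
  rw [gaussianReal_apply 0 hv0, hball]
  have hpdf : ∀ x, gaussianPDF 0 v x ≤ ENNReal.ofReal (1 / 2) := by
    intro x
    refine ENNReal.ofReal_le_ofReal ?_
    rw [gaussianPDFReal, one_div]
    refine mul_le_of_le_one_right (by positivity) (Real.exp_le_one_iff.mpr ?_) |>.trans ?_
    · exact div_nonpos_of_nonpos_of_nonneg (neg_nonpos.mpr (sq_nonneg _)) (by positivity)
    · apply inv_anti₀ (by norm_num)
      refine Real.le_sqrt_of_sq_le ?_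
      have h1 : (1 : ℝ) ≤ v := by exact_mod_cast hv
      nlinarith [Real.pi_gt_three]
  calc _ ≤ ∫⁻ _ in Metric.ball s r, ENNReal.ofReal (1 / 2) := lintegral_mono hpdf
    _ = ENNReal.ofReal r := by
      rw [setLIntegral_const, Real.volume_ball, ← ENNReal.ofReal_mul (by norm_num)]
      congr 1
      ring

/-- The entries `g i j` and `g j i` jointly encode one complex entry of the Hermitian matrix, so
sums agree only after pairing transposed positions. -/
theorem sum_sum_eq_of_symm {n : ℕ} {S T : Fin n → Fin n → ℝ}
    (h : ∀ i j, S i j + S j i = T i j + T j i) : ∑ i, ∑ j, S i j = ∑ i, ∑ j, T i j := by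
  have h1 : ∀ S : Fin n → Fin n → ℝ, ∑ i, ∑ j, (S i j + S j i) = 2 * ∑ i, ∑ j, S i j := by
    intro S
    simp only [Finset.sum_add_distrib]
    rw [Finset.sum_comm (f := fun i j => S j i)]
    ring
  have := h1 S
  simp only [h] at this
  linarith [h1 T]

theorem hermitianOfReal_of_lt {n : ℕ} (g : Fin n → Fin n → ℝ) {i j : Fin n} (h : i < j) :
    hermitianOfReal g i j = ((g i j / √2 : ℝ) : ℂ) + ((g j i / √2 : ℝ) : ℂ) * Complex.I ∧
    hermitianOfReal g j i = ((g i j / √2 : ℝ) : ℂ) - ((g j i / √2 : ℝ) : ℂ) * Complex.I := by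
  simp only [hermitianOfReal, Matrix.of_apply, h.ne, h.ne', h, not_lt.mpr h.le, if_true, if_false]
  constructor <;> push_cast <;> ring

theorem hermitianOfReal_self {n : ℕ} (g : Fin n → Fin n → ℝ) (i : Fin n) :
    hermitianOfReal g i i = (g i i : ℂ) := by
  simp [hermitianOfReal]

theorem frobeniusSq_hermitianOfReal {n : ℕ} (g : Fin n → Fin n → ℝ) :
    frobeniusSq (hermitianOfReal g) = ∑ i, ∑ j, g i j ^ 2 := by
  refine sum_sum_eq_of_symm fun i j => ?_
  have key : ∀ i j : Fin n, i < j → ‖hermitianOfReal g i j‖ ^ 2 + ‖hermitianOfReal g j i‖ ^ 2 =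
      g i j ^ 2 + g j i ^ 2 := by
    intro i j h
    obtain ⟨h1, h2⟩ := hermitianOfReal_of_lt g h
    rw [h1, h2, ← Complex.normSq_eq_norm_sq, ← Complex.normSq_eq_norm_sq]
    simp [Complex.normSq_apply]
    have := Real.sq_sqrt (show (0 : ℝ) ≤ 2 by norm_num)
    field_simp
    rw [this]
    ring
  rcases lt_trichotomy i j with h | h | h
  · exact key i j h
  · subst h; simp [hermitianOfReal_self]
  · linarith [key j i h]

/-- The coefficients of the real linear functional `g ↦ tr (hermitianOfReal g * B)`. -/
noncomputable def traceCoeff {n : ℕ} (B : Matrix (Fin n) (Fin n) ℂ) (i j : Fin n) : ℝ :=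
  if i = j then (B i i).re else if i < j then √2 * (B i j).re else -(√2 * (B i j).im)

theorem re_trace_hermitianOfReal_mul {n : ℕ} {B : Matrix (Fin n) (Fin n) ℂ} (hB : B.IsHermitian)
    (g : Fin n → Fin n → ℝ) :
    ∑ i, ∑ j, (hermitianOfReal g i j * B j i).re = ∑ i, ∑ j, traceCoeff B i j * g i j := by
  refine sum_sum_eq_of_symm fun i j => ?_
  have key : ∀ i j : Fin n, i < j → (hermitianOfReal g i j * B j i).re +
      (hermitianOfReal g j i * B i j).re = traceCoeff B i j * g i j + traceCoeff B j i * g j i := by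
    intro i j h
    obtain ⟨h1, h2⟩ := hermitianOfReal_of_lt g h
    have h3 : B i j = star (B j i) := (hB.apply i j).symm
    rw [h1, h2]
    simp only [traceCoeff, h.ne, h.ne', h, not_lt.mpr h.le, if_true, if_false]
    rw [h3]
    simp
    have := Real.sq_sqrt (show (0 : ℝ) ≤ 2 by norm_num)
    field_simp
    rw [this]
    ring
  rcases lt_trichotomy i j with h | h | h
  · exact key i j h
  · subst h; simp [hermitianOfReal_self, traceCoeff]; ring
  · linarith [key j i h]

/-- Thus `tr(G B)` has variance `frobeniusSq B` under the GUE, the form in which unitary invariance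
is used. -/
theorem sum_traceCoeff_sq {n : ℕ} {B : Matrix (Fin n) (Fin n) ℂ} (hB : B.IsHermitian) :
    ∑ i, ∑ j, traceCoeff B i j ^ 2 = frobeniusSq B := by
  refine sum_sum_eq_of_symm fun i j => ?_
  have key : ∀ i j : Fin n, i < j → traceCoeff B i j ^ 2 + traceCoeff B j i ^ 2 =
      ‖B i j‖ ^ 2 + ‖B j i‖ ^ 2 := by
    intro i j h
    have h3 : B i j = star (B j i) := (hB.apply i j).symm
    simp only [traceCoeff, h.ne, h.ne', h, not_lt.mpr h.le, if_true, if_false]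
    rw [h3, norm_star, ← Complex.normSq_eq_norm_sq]
    simp [Complex.normSq_apply, mul_pow]
    ring
  rcases lt_trichotomy i j with h | h | h
  · exact key i j h
  · subst h
    have h3 : (B i i).im = 0 := by
      have := congrArg Complex.im (hB.apply i i)
      simp at this
      linarith
    rw [← Complex.normSq_eq_norm_sq]
    simp [traceCoeff, Complex.normSq_apply, h3]
    ring
  · linarith [key j i h]

/-- The matrix `a x x* + b y y*`. -/
noncomputable def rankTwo {n : ℕ} (a b : ℝ) (x y : EuclideanSpace ℂ (Fin n)) :
    Matrix (Fin n) (Fin n) ℂ :=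
  Matrix.of fun i j => a * (x i * star (x j)) + b * (y i * star (y j))

theorem rankTwo_isHermitian {n : ℕ} (a b : ℝ) (x y : EuclideanSpace ℂ (Fin n)) :
    (rankTwo a b x y).IsHermitian := by
  ext i j
  simp [rankTwo]
  ring

theorem frobeniusSq_rankTwo {n : ℕ} (a b : ℝ) {x y : EuclideanSpace ℂ (Fin n)} (hx : ‖x‖ = 1)
    (hy : ‖y‖ = 1) (hxy : inner ℂ x y = 0) : frobeniusSq (rankTwo a b x y) = a ^ 2 + b ^ 2 := by
  have e1 : ∑ i, x i * star (x i) = 1 := by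
    have := inner_self_eq_norm_sq_to_K (𝕜 := ℂ) x
    rw [hx, PiLp.inner_apply] at this
    simpa [Complex.mul_conj'] using this
  have e2 : ∑ i, y i * star (y i) = 1 := by
    have := inner_self_eq_norm_sq_to_K (𝕜 := ℂ) y
    rw [hy, PiLp.inner_apply] at this
    simpa [Complex.mul_conj'] using this
  have e3 : ∑ i, y i * star (x i) = 0 := by
    rw [PiLp.inner_apply] at hxy
    simpa using hxy
  have e4 : ∑ i, x i * star (y i) = 0 := by
    have := congrArg star e3
    simpa [mul_comm] using this
  have : ((frobeniusSq (rankTwo a b x y) : ℝ) : ℂ) =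
      a ^ 2 * ((∑ i, x i * star (x i)) * ∑ j, x j * star (x j)) +
      b ^ 2 * ((∑ i, y i * star (y i)) * ∑ j, y j * star (y j)) +
      a * b * ((∑ i, x i * star (y i)) * ∑ j, y j * star (x j)) +
      a * b * ((∑ i, y i * star (x i)) * ∑ j, x j * star (y j)) := by
    rw [frobeniusSq]
    push_cast
    simp only [Finset.sum_mul_sum]
    simp only [Finset.mul_sum, ← Finset.sum_add_distrib]
    refine Finset.sum_congr rfl fun i _ => Finset.sum_congr rfl fun j _ => ?_
    rw [← Complex.mul_conj']
    simp [rankTwo]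
    ring
  rw [e1, e2, e3, e4] at this
  have h2 : ((frobeniusSq (rankTwo a b x y) : ℝ) : ℂ) = ((a ^ 2 + b ^ 2 : ℝ) : ℂ) := by
    rw [this]; push_cast; ring
  exact_mod_cast h2

theorem quadForm_add_quadForm {n : ℕ} (a b : ℝ) (x y : EuclideanSpace ℂ (Fin n))
    (G : Matrix (Fin n) (Fin n) ℂ) :
    a * quadForm G x + b * quadForm G y = ∑ i, ∑ j, (G i j * rankTwo a b x y j i).re := by
  have h : ∀ x : EuclideanSpace ℂ (Fin n), quadForm G x =
      ∑ i, ∑ j, (G i j * (x j * star (x i))).re := by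
    intro x
    rw [quadForm, PiLp.inner_apply, Complex.re_sum]
    refine Finset.sum_congr rfl fun i _ => ?_
    have : Matrix.toEuclideanLin G x i = ∑ j, G i j * x j := rfl
    rw [this, ← Complex.re_sum]
    congr 1
    simp only [RCLike.inner_apply, Finset.sum_mul]
    refine Finset.sum_congr rfl fun j _ => ?_
    simp
    ring
  rw [h, h, Finset.mul_sum, Finset.mul_sum, ← Finset.sum_add_distrib]
  refine Finset.sum_congr rfl fun i _ => ?_
  rw [Finset.mul_sum, Finset.mul_sum, ← Finset.sum_add_distrib]
  refine Finset.sum_congr rfl fun j _ => ?_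
  rw [← Complex.re_ofReal_mul, ← Complex.re_ofReal_mul, ← Complex.add_re]
  congr 1
  simp [rankTwo]
  ring

theorem measurable_quadForm {n : ℕ} (x : EuclideanSpace ℂ (Fin n)) :
    Measurable fun G : Matrix (Fin n) (Fin n) ℂ => quadForm G x := by
  have h : (fun G : Matrix (Fin n) (Fin n) ℂ => quadForm G x) =
      fun G => ∑ i, ∑ j, (G i j * rankTwo 1 0 x x j i).re := by
    ext G
    rw [← quadForm_add_quadForm]
    ring
  rw [h]
  have : ∀ i j, Measurable fun G : Matrix (Fin n) (Fin n) ℂ => G i j := fun i j =>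
    (measurable_pi_apply j).comp (measurable_pi_apply (X := fun _ : Fin n => Fin n → ℂ) i)
  fun_prop

theorem measurable_frobeniusSq {n : ℕ} :
    Measurable (frobeniusSq : Matrix (Fin n) (Fin n) ℂ → ℝ) := by
  have : ∀ i j, Measurable fun G : Matrix (Fin n) (Fin n) ℂ => G i j := fun i j =>
    (measurable_pi_apply j).comp (measurable_pi_apply (X := fun _ : Fin n => Fin n → ℂ) i)
  unfold frobeniusSq
  fun_prop

/-- Anti-concentration of a combination of two diagonal entries of a GUE matrix in an orthonormal
basis. -/
theorem gue_abs_quadForm_sub_lt_le {n : ℕ} {a b : ℝ} (hab : 1 ≤ a ^ 2 + b ^ 2)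
    {x y : EuclideanSpace ℂ (Fin n)} (hx : ‖x‖ = 1) (hy : ‖y‖ = 1) (hxy : inner ℂ x y = 0)
    (s r : ℝ) :
    gue n {G | |a * quadForm G x + b * quadForm G y - s| < r} ≤ ENNReal.ofReal r := by
  have hx' := measurable_quadForm x
  have hy' := measurable_quadForm y
  rw [gue, Measure.map_apply measurable_hermitianOfReal
    (measurableSet_lt (by fun_prop) (by fun_prop))]
  have hB := rankTwo_isHermitian a b x y
  have e : hermitianOfReal ⁻¹' {G | |a * quadForm G x + b * quadForm G y - s| < r} =
      (fun g : Fin n → Fin n → ℝ => ∑ i, ∑ j, traceCoeff (rankTwo a b x y) i j * g i j) ⁻¹'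
        {y | |y - s| < r} := by
    ext g
    simp only [Set.mem_preimage, Set.mem_ofPred_eq, quadForm_add_quadForm,
      re_trace_hermitianOfReal_mul hB]
  rw [e, ← Measure.map_apply (by fun_prop) (measurableSet_lt (by fun_prop) (by fun_prop))]
  have hv : (1 : NNReal) ≤ ∑ i, ∑ j, NNReal.mk (traceCoeff (rankTwo a b x y) i j ^ 2) (sq_nonneg _) := by
    rw [← NNReal.coe_le_coe]
    push_cast
    rw [sum_traceCoeff_sq hB, frobeniusSq_rankTwo a b hx hy hxy]
    exact hab
  have := gaussianReal_abs_sub_lt_le hv s r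
  rwa [← map_linear_gaussianArray] at this

/-- Markov's inequality: the squared norm is a sum of `n²` squares of standard Gaussians, with mean
`n²`. -/
theorem gue_frobeniusSq_gt_le {n : ℕ} {R : ℝ} (hR : 0 < R) :
    (gue n).real {G | R < frobeniusSq G} ≤ n ^ 2 / R := by
  rw [gue, map_measureReal_apply measurable_hermitianOfReal
    (measurableSet_lt measurable_const measurable_frobeniusSq)]
  have hc : ∀ i j : Fin n, MeasurePreserving (fun g : Fin n → Fin n → ℝ => g i j)
      (gaussianArray n) (gaussianReal 0 1) := fun i j =>
    (measurePreserving_eval (fun _ : Fin n => gaussianReal 0 1) j).comp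
      (measurePreserving_eval
        (fun _ : Fin n => Measure.pi fun _ : Fin n => gaussianReal 0 1) i)
  have hint0 : Integrable (fun x : ℝ => x ^ 2) (gaussianReal 0 1) :=
    (memLp_id_gaussianReal 2).integrable_sq
  have hval0 : ∫ x, x ^ 2 ∂(gaussianReal 0 1) = 1 := by
    have := variance_id_gaussianReal (μ := 0) (v := 1)
    rw [variance_eq_integral (by fun_prop)] at this
    simpa using this
  have hint : ∀ i j : Fin n, Integrable (fun g : Fin n → Fin n → ℝ => g i j ^ 2)
      (gaussianArray n) := fun i j => (hc i j).integrable_comp_of_integrable hint0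
  have hval : ∀ i j : Fin n, ∫ g, g i j ^ 2 ∂(gaussianArray n) = 1 := fun i j => by
    rw [← hval0, ← (hc i j).map_eq, integral_map (hc i j).aemeasurable (by fun_prop)]
  have hm := mul_meas_ge_le_integral_of_nonneg (μ := gaussianArray n)
    (f := fun g => ∑ i, ∑ j, g i j ^ 2)
    (Filter.Eventually.of_forall fun g => by positivity)
    (integrable_finsetSum _ fun i _ => integrable_finsetSum _ fun j _ => hint i j) R
  rw [integral_finsetSum _ fun i _ => integrable_finsetSum _ fun j _ => hint i j] at hm
  simp_rw [integral_finsetSum _ fun j _ => hint _ j, hval] at hm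
  rw [le_div_iff₀ hR, mul_comm]
  refine le_trans (mul_le_mul_of_nonneg_left (measureReal_mono ?_) hR.le) (hm.trans ?_)
  · intro g hg
    have : R < frobeniusSq (hermitianOfReal g) := hg
    rw [frobeniusSq_hermitianOfReal] at this
    exact this.le
  · simp [sq]

/-! ### Averaging over an independent uniform integer -/

open Classical in
theorem uniformOn_range_apply {M : ℕ} (hM : 0 < M) (t : Set ℕ) :
    uniformOn (Finset.range M : Set ℕ) t =
      ENNReal.ofReal (((Finset.range M).filter (· ∈ t)).card / M) := by
  have h : (Finset.range M : Set ℕ) ∩ t = ((Finset.range M).filter (· ∈ t) : Finset ℕ) := by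
    ext; simp
  rw [uniformOn, cond_apply (Finset.measurableSet _), h, Measure.count_apply_finset,
    Measure.count_apply_finset, Finset.card_range, ENNReal.ofReal_div_of_pos (by positivity),
    ENNReal.ofReal_natCast, ENNReal.ofReal_natCast, mul_comm, ENNReal.div_eq_inv_mul, mul_comm]

open Classical in
/-- Lower bound for the probability of an event on a pair of an arbitrary and an independent
uniformly distributed variable, through the sections of the event. -/
theorem mul_measureReal_le_of_card_ge {Ω 𝓧 : Type*} [MeasurableSpace Ω] [MeasurableSpace 𝓧]
    {P : Measure Ω} [IsProbabilityMeasure P] {μ : Measure 𝓧} [IsProbabilityMeasure μ]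
    {X : Ω → 𝓧} {m : Ω → ℕ} {M : ℕ} (hX : HasLaw X μ P)
    (hm : HasLaw m (uniformOn (Finset.range M : Set ℕ)) P) (hXm : IndepFun X m P) (hM : 0 < M)
    {U : Set 𝓧} (hU : MeasurableSet U) {S : ℕ → Set 𝓧} (hS : ∀ i, MeasurableSet (U ∩ S i)) {p : ℝ}
    (hp : 0 ≤ p) (hc : ∀ x ∈ U, p * M ≤ ((Finset.range M).filter fun i => x ∈ S i).card) :
    p * μ.real U ≤ P.real {ω | X ω ∈ S (m ω)} := by
  set ν := uniformOn (Finset.range M : Set ℕ) with hν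
  have hM0 : (0 : ℝ) < M := by exact_mod_cast hM
  have : IsProbabilityMeasure ν :=
    isProbabilityMeasure_uniformOn (Finset.finite_toSet _) (by simpa using hM.ne')
  -- Measurability is needed only inside `U`; the second coordinate is countable, so sections
  -- suffice.
  have hT : MeasurableSet {x : 𝓧 × ℕ | x.1 ∈ U ∩ S x.2} := by
    have : Measurable fun x : 𝓧 × ℕ => x.1 ∈ U ∩ S x.2 :=
      measurable_from_prod_countable_left fun i => measurableSet_setOfPred.mp (hS i)
    exact measurableSet_setOfPred.mpr this
  have hlaw := hXm.hasLaw_prod hX hm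
  have h1 : P {ω | X ω ∈ U ∩ S (m ω)} = (μ.prod ν) {x : 𝓧 × ℕ | x.1 ∈ U ∩ S x.2} :=
    hlaw.measure_eq hT
  have h2 : ENNReal.ofReal p * μ U ≤ (μ.prod ν) {x : 𝓧 × ℕ | x.1 ∈ U ∩ S x.2} := by
    rw [Measure.prod_apply hT]
    calc ENNReal.ofReal p * μ U = ∫⁻ _ in U, ENNReal.ofReal p ∂μ := by rw [setLIntegral_const]
      _ ≤ ∫⁻ x in U, ν (Prod.mk x ⁻¹' {x : 𝓧 × ℕ | x.1 ∈ U ∩ S x.2}) ∂μ := by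
        refine setLIntegral_mono' hU fun x hx => ?_
        rw [hν, uniformOn_range_apply hM]
        refine ENNReal.ofReal_le_ofReal ((le_div_iff₀ hM0).mpr ((hc x hx).trans ?_))
        gcongr with i _
        exact fun hi => ⟨hx, hi⟩
      _ ≤ _ := setLIntegral_le_lintegral _ _
  rw [← h1] at h2
  have h3 := ENNReal.toReal_mono (measure_ne_top _ _) h2
  rw [ENNReal.toReal_mul, ENNReal.toReal_ofReal hp] at h3
  exact h3.trans (measureReal_mono fun ω hω => hω.2)

/-! ### Measurability of the separation event -/

theorem fract_mem_bIn_iff {n : ℕ} {α x : ℝ} :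
    Int.fract x ∈ bIn n α ↔ distInt x ≤ 1 / (α * n) := by
  refine ⟨fun h => ?_, fract_mem_bIn⟩
  obtain ⟨y, hy, hxy⟩ := h
  obtain ⟨z, hz⟩ := Int.fract_eq_fract.mp hxy.symm
  refine (distInt_le x z).trans (abs_le.mpr ?_)
  constructor <;> linarith [hy.1, hy.2]

theorem fract_mem_bOut_iff {n : ℕ} {x : ℝ} :
    Int.fract x ∈ bOut n ↔ distInt x ≤ 1 / (4 * n) := by
  refine ⟨distInt_le_of_fract_mem_bOut, fun h => ?_⟩
  have h' := abs_le.mp h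
  refine ⟨x - round x + 1, ⟨by linarith [h'.1], by linarith [h'.2]⟩, ?_⟩
  rw [Int.fract_add_one, Int.fract_sub_intCast]

theorem measurable_distInt : Measurable distInt := by
  have : distInt = fun x => min (Int.fract x) (1 - Int.fract x) :=
    funext fun x => abs_sub_round_eq_min x
  rw [this]
  exact measurable_fract.min (measurable_const.sub measurable_fract)

theorem measurableSet_separates {n : ℕ} (α : ℝ) (k : Fin n) (m : ℕ) :
    MeasurableSet {l : Fin n → ℝ | Separates α l k m} := by
  simp only [Separates, fract_mem_bIn_iff, fract_mem_bOut_iff]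
  have hd := measurable_distInt
  have h : ∀ j : Fin n, ∀ c : ℝ, MeasurableSet {l : Fin n → ℝ | distInt (m * l j) ≤ c} := fun j c =>
    measurableSet_le (by fun_prop) measurable_const
  refine (MeasurableSet.const _).inter ((h k _).inter ?_)
  have : {l : Fin n → ℝ | ∀ j, j ≠ k → ¬ distInt (m * l j) ≤ 1 / (4 * n)} =
      ⋂ j, ⋂ (_ : j ≠ k), {l : Fin n → ℝ | distInt (m * l j) ≤ 1 / (4 * n)}ᶜ := by
    ext; simp
  change MeasurableSet {l : Fin n → ℝ | ∀ j, j ≠ k → ¬ distInt (m * l j) ≤ 1 / (4 * n)}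
  rw [this]
  exact MeasurableSet.iInter fun j => MeasurableSet.iInter fun _ => (h j _).compl

instance borelSpace_matrix {n : ℕ} : BorelSpace (Matrix (Fin n) (Fin n) ℂ) :=
  inferInstanceAs (BorelSpace (Fin n → Fin n → ℂ))

theorem continuous_frobeniusSq {n : ℕ} :
    Continuous (frobeniusSq : Matrix (Fin n) (Fin n) ℂ → ℝ) := by
  unfold frobeniusSq
  fun_prop

open Classical in
/-- The sorted eigenvalues of a Hermitian matrix, extended by `0` to all matrices. -/
noncomputable def sortedEigenvaluesOrZero {n : ℕ} (B : Matrix (Fin n) (Fin n) ℂ) : Fin n → ℝ :=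
  if h : B.IsHermitian then sortedEigenvalues h else 0

theorem sortedEigenvaluesOrZero_eq {n : ℕ} {B : Matrix (Fin n) (Fin n) ℂ} (h : B.IsHermitian) :
    sortedEigenvaluesOrZero B = sortedEigenvalues h := dif_pos h

/-- For bounded `G` the spectrum of `A + zG` keeps gaps of at least `δ/2`, so the stability bound
applies again around each such matrix. -/
theorem continuousOn_sortedEigenvaluesOrZero {n : ℕ} {A : Matrix (Fin n) (Fin n) ℂ}
    {δ z R : ℝ} (hA : A.IsHermitian)
    (hd : ∀ i j, i < j → δ ≤ sortedEigenvalues hA i - sortedEigenvalues hA j) (hδ : 0 < δ)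
    (hz : 0 < z) (hR : 0 ≤ R) (hzR : 6 * (z * R) ≤ δ) :
    ContinuousOn (fun G => sortedEigenvaluesOrZero (A + (z : ℂ) • G))
      {G | G.IsHermitian ∧ frobeniusSq G ≤ R ^ 2} := by
  have hzR0 : 0 ≤ z * R := mul_nonneg hz.le hR
  refine continuousOn_pi.mpr fun k G ⟨hG, hGR⟩ => Metric.tendsto_nhds.mpr fun ε hε => ?_
  have hB := isHermitian_add_smul hA hG z
  have hgap : ∀ i j, i < j → δ / 2 ≤ sortedEigenvalues hB i - sortedEigenvalues hB j := by
    have h : ∀ i, |sortedEigenvalues hB i - sortedEigenvalues hA i| ≤ z * R := by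
      refine fun i => abs_sortedEigenvalues_sub_le hA hB hd hzR0 (by linarith) ?_ i
      rw [add_sub_cancel_left, frobeniusSq_smul, mul_pow]
      gcongr
    intro i j hij
    linarith [hd i j hij, (abs_le.mp (h i)).1, (abs_le.mp (h j)).2]
  set ρ := min (δ / 8) (ε / 2) with hρ
  have hρ0 : 0 < ρ := by positivity
  have hcont : Continuous fun G' : Matrix (Fin n) (Fin n) ℂ =>
      frobeniusSq ((z : ℂ) • (G' - G)) := continuous_frobeniusSq.comp (by fun_prop)
  have hmem : G ∈ {G' | frobeniusSq ((z : ℂ) • (G' - G)) < ρ ^ 2} := by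
    rw [Set.mem_ofPred_eq, sub_self, smul_zero]
    simpa [frobeniusSq] using pow_pos hρ0 2
  filter_upwards [self_mem_nhdsWithin,
    mem_nhdsWithin_of_mem_nhds ((isOpen_lt hcont continuous_const).mem_nhds hmem)] with
    G' ⟨hG'H, _⟩ hG'
  have hB' := isHermitian_add_smul hA hG'H z
  rw [Real.dist_eq, sortedEigenvaluesOrZero_eq hB, sortedEigenvaluesOrZero_eq hB']
  have h8 : ρ ≤ δ / 8 := min_le_left _ _
  have h2 : ρ ≤ ε / 2 := min_le_right _ _
  have := abs_sortedEigenvalues_sub_le hB hB' hgap hρ0.le (by linarith) (by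
    rw [add_sub_add_left_eq_sub, ← smul_sub]; exact le_of_lt hG') k
  linarith

theorem measurableSet_isHermitian {n : ℕ} :
    MeasurableSet {G : Matrix (Fin n) (Fin n) ℂ | G.IsHermitian} := by
  have : IsClosed {G : Matrix (Fin n) (Fin n) ℂ | G.IsHermitian} :=
    isClosed_eq (by fun_prop) continuous_id
  exact this.measurableSet

theorem measurableSet_inter_separates {n : ℕ} {A : Matrix (Fin n) (Fin n) ℂ}
    {δ z R : ℝ} (hA : A.IsHermitian)
    (hd : ∀ i j, i < j → δ ≤ sortedEigenvalues hA i - sortedEigenvalues hA j) (hδ : 0 < δ)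
    (hz : 0 < z) (hR : 0 ≤ R) (hzR : 6 * (z * R) ≤ δ) {U : Set (Matrix (Fin n) (Fin n) ℂ)}
    (hU : MeasurableSet U) (hUR : U ⊆ {G | G.IsHermitian ∧ frobeniusSq G ≤ R ^ 2}) (α : ℝ)
    (k : Fin n) (m : ℕ) :
    MeasurableSet (U ∩ {G | SeparatesEigenvalue α (A + (z : ℂ) • G) k m}) := by
  have hc := (continuousOn_sortedEigenvaluesOrZero hA hd hδ hz hR hzR).mono hUR
  have hmeas := (continuousOn_iff_continuous_domRestrict.mp hc).measurable
  have h := hU.subtype_image (hmeas (measurableSet_separates α k m))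
  convert h using 1
  ext G
  constructor
  · rintro ⟨hG, hB, hs⟩
    refine ⟨⟨G, hG⟩, ?_, rfl⟩
    change Separates α (sortedEigenvaluesOrZero (A + (z : ℂ) • G)) k m
    rwa [sortedEigenvaluesOrZero_eq hB]
  · rintro ⟨⟨G, hG⟩, hs, rfl⟩
    have hB := isHermitian_add_smul hA (hUR hG).1 z
    change Separates α (sortedEigenvaluesOrZero (A + (z : ℂ) • G)) k m at hs
    rw [sortedEigenvaluesOrZero_eq hB] at hs
    exact ⟨hG, hB, hs⟩

/-! ### Nonresonance of the perturbed eigenvalues -/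

/-- If `x` is close to `c + w` with `w` small, and `c + w` is not close to the integer nearest to
`c`, then `x` is not close to any integer. -/
theorem le_distInt_of_le_abs_sub_round {x c w t e s : ℝ} (hx : |x - (c + w)| ≤ e) (hw : |w| ≤ s)
    (hs : t + e + s < 1 / 2) (h : t + e ≤ |w - (round c - c)|) : t ≤ distInt x := by
  by_contra! hlt
  rw [distInt] at hlt
  have h1 : |c + w - round x| < t + e := by
    have := abs_sub_le (c + w) x (round x)
    rw [abs_sub_comm (c + w) x] at this
    linarith
  -- The total shift is below `1/2`, so one target integer per frequency suffices.
  have h2 : round c = round x := by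
    rw [round_eq_iff]
    have := abs_lt.mp h1
    have := abs_le.mp hw
    constructor <;> linarith
  rw [h2] at h
  have : w - (round x - c) = c + w - round x := by ring
  rw [this] at h
  linarith

/-- The nonzero pairs of integers of absolute value at most `K`. -/
noncomputable def frequencies (K : ℕ) : Finset (ℤ × ℤ) :=
  (Finset.Icc (-(K : ℤ)) K ×ˢ Finset.Icc (-(K : ℤ)) K).erase (0, 0)

theorem mem_frequencies {K : ℕ} {p : ℤ × ℤ} :
    p ∈ frequencies K ↔ |p.1| ≤ K ∧ |p.2| ≤ K ∧ p ≠ (0, 0) := by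
  simp only [frequencies, Finset.mem_erase, Finset.mem_product, Finset.mem_Icc, abs_le]
  tauto

theorem card_frequencies_le (K : ℕ) : (frequencies K).card ≤ (2 * K + 1) ^ 2 := by
  refine (Finset.card_erase_le).trans (le_of_eq ?_)
  rw [Finset.card_product, Int.card_Icc, sq]
  have : ((K : ℤ) + 1 - -(K : ℤ)).toNat = 2 * K + 1 := by omega
  rw [this]

theorem one_le_sq_add_sq_of_mem_frequencies {K : ℕ} {p : ℤ × ℤ} (hp : p ∈ frequencies K) :
    (1 : ℝ) ≤ (p.1 : ℝ) ^ 2 + (p.2 : ℝ) ^ 2 := by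
  have h : (1 : ℤ) ≤ p.1 ^ 2 + p.2 ^ 2 := by
    obtain ⟨-, -, h⟩ := mem_frequencies.mp hp
    by_contra! hc
    refine h (Prod.ext ?_ ?_) <;> simp only
    · exact pow_eq_zero_iff two_ne_zero |>.mp (by nlinarith [sq_nonneg p.1, sq_nonneg p.2])
    · exact pow_eq_zero_iff two_ne_zero |>.mp (by nlinarith [sq_nonneg p.1, sq_nonneg p.2])
  exact_mod_cast h

/-- The perturbations of bounded size for which no small integer combination of the first-order
approximations of two eigenvalues is close to an integer. -/
def nonresonant {n : ℕ} (a : OrthonormalBasis (Fin n) ℂ (EuclideanSpace ℂ (Fin n)))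
    (d : Fin n → ℝ) (z R τ : ℝ) (K : ℕ) (k : Fin n) : Set (Matrix (Fin n) (Fin n) ℂ) :=
  {G | G.IsHermitian} ∩ {G | frobeniusSq G ≤ R ^ 2} ∩
    ⋂ q ∈ Finset.univ.erase k ×ˢ frequencies K,
      {G | |q.2.1 * quadForm G (a k) + q.2.2 * quadForm G (a q.1) -
        (round (q.2.1 * d k + q.2.2 * d q.1) - (q.2.1 * d k + q.2.2 * d q.1)) / z| < τ}ᶜ

section nonresonant

variable {n : ℕ} {a : OrthonormalBasis (Fin n) ℂ (EuclideanSpace ℂ (Fin n))}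
  {d : Fin n → ℝ} {z R τ : ℝ} {K : ℕ} {k : Fin n}

theorem measurableSet_nonresonant : MeasurableSet (nonresonant a d z R τ K k) := by
  have hq := fun i => measurable_quadForm (a i)
  refine (measurableSet_isHermitian.inter
    (measurableSet_le measurable_frobeniusSq measurable_const)).inter
    (Finset.measurableSet_biInter _ fun q _ => MeasurableSet.compl ?_)
  exact measurableSet_lt (by fun_prop) measurable_const

/-- Markov handles the norm; a union bound handles at most `n (2K + 1)²` resonances, each of
probability at most `τ`. -/
theorem gue_nonresonant_compl_le (hR : 0 < R) (hτ : 0 ≤ τ) :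
    (gue n).real (nonresonant a d z R τ K k)ᶜ ≤ n ^ 2 / R ^ 2 + n * (2 * K + 1) ^ 2 * τ := by
  rw [nonresonant, Set.compl_inter, Set.compl_inter, Set.compl_iInter₂]
  simp only [compl_compl]
  refine (measureReal_union_le _ _).trans (add_le_add ((measureReal_union_le _ _).trans ?_) ?_)
  · have h1 : (gue n).real {G : Matrix (Fin n) (Fin n) ℂ | G.IsHermitian}ᶜ = 0 := by
      rw [gue, map_measureReal_apply measurable_hermitianOfReal measurableSet_isHermitian.compl]
      convert measureReal_empty
      ext g
      simp [hermitianOfReal_isHermitian]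
    rw [h1, zero_add]
    refine le_trans (measureReal_mono ?_) (gue_frobeniusSq_gt_le (pow_pos hR 2))
    intro G hG
    simpa using hG
  · refine (measureReal_biUnion_finset_le _ _).trans ?_
    refine (Finset.sum_le_card_nsmul _ _ τ fun q hq => ?_).trans ?_
    · obtain ⟨h1, h2⟩ := Finset.mem_product.mp hq
      have hne := Finset.ne_of_mem_erase h1
      have := gue_abs_quadForm_sub_lt_le (one_le_sq_add_sq_of_mem_frequencies h2)
        (a.norm_eq_one k) (a.norm_eq_one q.1) (a.orthonormal.2 hne.symm)
        ((round (q.2.1 * d k + q.2.2 * d q.1) - (q.2.1 * d k + q.2.2 * d q.1)) / z) τ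
      exact ENNReal.toReal_le_of_le_ofReal hτ this
    · rw [nsmul_eq_mul]
      refine mul_le_mul_of_nonneg_right ?_ hτ
      rw [Finset.card_product, Nat.cast_mul]
      gcongr
      · refine (Finset.card_erase_le).trans ?_
        simp
      · exact_mod_cast card_frequencies_le K

/-- Coefficients of size `K` amplify the two second-order errors to at most `2K · 16(zR)²/δ`, which
the margin `zτ` absorbs. -/
theorem le_distInt_of_mem_nonresonant {A G : Matrix (Fin n) (Fin n) ℂ} {δ t : ℝ}
    (hA : A.IsHermitian)
    (hd : ∀ i j, i < j → δ ≤ sortedEigenvalues hA i - sortedEigenvalues hA j) (hδ : 0 < δ)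
    (hz : 0 < z) (hR : 0 ≤ R) (hzR : 6 * (z * R) ≤ δ)
    (ha : ∀ i, Matrix.toEuclideanLin A (a i) = (sortedEigenvalues hA i : ℂ) • a i)
    (hG : G ∈ nonresonant a (sortedEigenvalues hA) z R τ K k)
    (hτ : t + 2 * K * (16 * (z * R) ^ 2 / δ) ≤ z * τ)
    (hs : t + 2 * K * (16 * (z * R) ^ 2 / δ) + 2 * K * (z * R) < 1 / 2)
    (hH : (A + (z : ℂ) • G).IsHermitian)
    {j : Fin n} (hj : j ≠ k) {b c : ℤ} (hb : |b| ≤ K) (hc : |c| ≤ K) (hbc : (b, c) ≠ (0, 0)) :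
    t ≤ distInt (b * sortedEigenvalues hH k + c * sortedEigenvalues hH j) := by
  obtain ⟨⟨hGH, hGR⟩, hG⟩ := hG
  have hG := Set.mem_iInter₂.mp hG (j, b, c) (Finset.mem_product.mpr
    ⟨Finset.mem_erase.mpr ⟨hj, Finset.mem_univ j⟩, mem_frequencies.mpr ⟨hb, hc, hbc⟩⟩)
  simp only [Set.mem_compl_iff, Set.mem_ofPred_eq, not_lt] at hG
  have hpert := fun i => abs_sortedEigenvalues_add_smul_sub_le hA hGH hd hδ hz.le hR hzR hGR ha i
  have hq := fun i => abs_quadForm_le hR hGR (a.norm_eq_one i)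
  have hb' : |(b : ℝ)| ≤ K := by exact_mod_cast hb
  have hc' : |(c : ℝ)| ≤ K := by exact_mod_cast hc
  set e := 16 * (z * R) ^ 2 / δ
  refine le_distInt_of_le_abs_sub_round
    (c := b * sortedEigenvalues hA k + c * sortedEigenvalues hA j)
    (w := z * (b * quadForm G (a k) + c * quadForm G (a j))) ?_ ?_ hs ?_
  · have : b * sortedEigenvalues hH k + c * sortedEigenvalues hH j -
        (b * sortedEigenvalues hA k + c * sortedEigenvalues hA j +
          z * (b * quadForm G (a k) + c * quadForm G (a j))) =
        b * (sortedEigenvalues hH k - (sortedEigenvalues hA k + z * quadForm G (a k))) +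
        c * (sortedEigenvalues hH j - (sortedEigenvalues hA j + z * quadForm G (a j))) := by ring
    rw [this]
    calc _ ≤ K * e + K * e := by
          refine (abs_add_le _ _).trans ?_
          rw [abs_mul, abs_mul]
          gcongr
          · exact hpert k
          · exact hpert j
      _ = _ := by ring
  · calc _ ≤ z * (K * R + K * R) := by
          rw [abs_mul, abs_of_pos hz]
          gcongr
          refine (abs_add_le _ _).trans ?_
          rw [abs_mul, abs_mul]
          gcongr
          · exact hq k
          · exact hq j
      _ = _ := by ring
  · refine hτ.trans ?_
    calc z * τ ≤ z * |_| := mul_le_mul_of_nonneg_left hG hz.le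
      _ = _ := by
        rw [← abs_of_pos hz, ← abs_mul, abs_of_pos hz, mul_sub]
        congr 2
        field_simp

end nonresonant

/-! ### Choice of parameters and conclusion -/

/-- The numerical inequalities between the parameters. -/
theorem parameter_bounds {n δ ζ p : ℝ} (hn : 5 ≤ n) (hδ : 0 < δ) (hζ : 0 < ζ)
    (hζδ : ζ ≤ δ ^ 13) (hζn : ζ ≤ (1 / n) ^ 50) (hp : 0 ≤ p) (hpn : p ≤ (1 / n) ^ 30) :
    6 * (ζ * (5 * n)) ≤ δ ∧
    (n * (2 * n ^ 8 + 1) ^ 2 * (n ^ 9 * p / 2 + 800 * n ^ 10 * (ζ / δ)) ≤ 1 / 20) ∧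
    ζ * (n ^ 9 * p / 2 + 800 * n ^ 10 * (ζ / δ)) + 2 * n ^ 8 * (ζ * (5 * n)) < 1 / 2 := by
  have hn0 : 0 < n := by linarith
  set r := 1 / n with hr
  have hr0 : 0 < r := by positivity
  have hr5 : r ≤ 1 / 5 := by rw [hr]; exact one_div_le_one_div_of_le (by norm_num) hn
  have hnr : n = 1 / r := by rw [hr, one_div_one_div]
  -- Both bounds on `ζ` enter: `(ζ/δ)^13 = ζ^12 · (ζ/δ^13) ≤ r^600`, and `46 · 13 = 598`.
  have hx : ζ / δ ≤ r ^ 46 := by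
    have h13 : (ζ / δ) ^ 13 ≤ (r ^ 46) ^ 13 := by
      calc (ζ / δ) ^ 13 = ζ ^ 12 * (ζ / δ ^ 13) := by field_simp
        _ ≤ (r ^ 50) ^ 12 * 1 := by
          gcongr
          exact (div_le_one (by positivity)).mpr hζδ
        _ = r ^ 600 := by ring
        _ ≤ r ^ 598 := pow_le_pow_of_le_one hr0.le (by linarith) (by norm_num)
        _ = _ := by ring
    exact le_of_pow_le_pow_left₀ (by norm_num) (by positivity) h13
  have hx0 : 0 ≤ ζ / δ := by positivity
  have hτ : n ^ 9 * p / 2 + 800 * n ^ 10 * (ζ / δ) ≤ r ^ 21 := by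
    calc _ ≤ n ^ 9 * r ^ 30 / 2 + 800 * n ^ 10 * r ^ 46 := by gcongr
      _ = r ^ 21 * (1 / 2 + 800 * r ^ 15) := by rw [hnr]; field_simp
      _ ≤ r ^ 21 * (1 / 2 + 800 * (1 / 5) ^ 15) := by gcongr
      _ ≤ r ^ 21 * 1 := by gcongr; norm_num
      _ = r ^ 21 := mul_one _
  have hτ0 : 0 ≤ n ^ 9 * p / 2 + 800 * n ^ 10 * (ζ / δ) := by positivity
  refine ⟨?_, ?_, ?_⟩
  · have : 30 * n * (ζ / δ) ≤ 1 := by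
      calc _ ≤ 30 * n * r ^ 46 := by gcongr
        _ = 30 * r ^ 45 := by rw [hnr]; field_simp
        _ ≤ 30 * (1 / 5) ^ 45 := by gcongr
        _ ≤ 1 := by norm_num
    rw [mul_div_assoc', div_le_one hδ] at this
    linarith
  · calc _ ≤ n * (2 * n ^ 8 + n ^ 8) ^ 2 * r ^ 21 := by
          gcongr
          exact one_le_pow₀ (by linarith)
      _ = 9 * r ^ 4 := by rw [hnr]; field_simp; ring
      _ ≤ 9 * (1 / 5) ^ 4 := by gcongr
      _ ≤ 1 / 20 := by norm_num
  · calc _ ≤ r ^ 50 * r ^ 21 + 2 * n ^ 8 * (r ^ 50 * (5 * n)) := by gcongr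
      _ = r ^ 71 + 10 * r ^ 41 := by rw [hnr]; field_simp; ring
      _ ≤ (1 / 5) ^ 71 + 10 * (1 / 5) ^ 41 := by gcongr
      _ < 1 / 2 := by norm_num

theorem mainTheorem2 {n : ℕ} {δ ζ α : ℝ} {M : ℕ} {A : Matrix (Fin n) (Fin n) ℂ}
    (hδ : 0 < δ) (hA : IsSeparatedMatrix δ A)
    (hζ_pos : 0 < ζ) (hζ : ζ ≤ min (δ ^ 13) ((n : ℝ) ^ (-50 : ℤ)))
    (hα : 4 < α) (hαn : α ≤ n)
    (hM : ζ ^ (-1.6 : ℝ) ≤ (M : ℝ))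
    {Ω : Type*} [MeasurableSpace Ω] {P : Measure Ω} [IsProbabilityMeasure P]
    {E : Ω → Matrix (Fin n) (Fin n) ℂ} {m : Ω → ℕ}
    (hE : HasLaw E (gue n) P)
    (hm : HasLaw m (uniformOn (Finset.range M : Set ℕ)) P)
    (hEm : IndepFun E m P) (k : Fin n) :
    1 / (5 * α * n) ≤ P.real {ω | SeparatesEigenvalue α (A + (ζ : ℂ) • E ω) k (m ω)} := by
  classical
  have hn : 5 ≤ n := by
    have : (4 : ℝ) < n := by linarith
    exact_mod_cast this
  have hn5 : (5 : ℝ) ≤ n := by exact_mod_cast hn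
  have hM0 : 0 < M := by
    have : (0 : ℝ) < M := (Real.rpow_pos_of_pos hζ_pos _).trans_le hM
    exact_mod_cast this
  have hAH := hA.posSemidef.isHermitian
  have hd := hA.le_sub
  obtain ⟨a, ha⟩ := exists_orthonormalBasis_sortedEigenvalues hAH
  set p := ζ ^ (0.6 : ℝ) with hp
  have hp0 : 0 < p := Real.rpow_pos_of_pos hζ_pos _
  have hζn : ζ ≤ (1 / (n : ℝ)) ^ 50 := by
    have : ((n : ℝ) ^ (-50 : ℤ)) = (1 / (n : ℝ)) ^ 50 := by
      rw [one_div, inv_pow]; exact zpow_neg _ _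
    exact this ▸ hζ.trans (min_le_right _ _)
  have hpn : p ≤ (1 / (n : ℝ)) ^ 30 := by
    calc p ≤ ((1 / (n : ℝ)) ^ 50) ^ (0.6 : ℝ) := Real.rpow_le_rpow hζ_pos.le hζn (by norm_num)
      _ = (1 / (n : ℝ)) ^ 30 := by
        rw [← Real.rpow_natCast, ← Real.rpow_mul (by positivity), ← Real.rpow_natCast]
        norm_num
  obtain ⟨hzR, hunion, hsmall⟩ :=
    parameter_bounds hn5 hδ hζ_pos (hζ.trans (min_le_left _ _)) hζn hp0.le hpn
  -- The value of `τ` solves `ζ τ = t + 2K · 16(ζR)²/δ` for `K = n^8` and `R = 5n`; `t` is chosen so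
  -- that `n^9 / (2t) = ζ^(-1.6)`.
  set τ := (n : ℝ) ^ 9 * p / 2 + 800 * n ^ 10 * (ζ / δ) with hτ
  have hτ0 : 0 ≤ τ := by positivity
  set t := (n : ℝ) ^ 9 * (ζ * p) / 2 with ht
  have ht0 : 0 < t := by positivity
  have hK : ((n ^ 8 : ℕ) : ℝ) = (n : ℝ) ^ 8 := by push_cast; rfl
  have hzτ : t + 2 * (n ^ 8 : ℕ) * (16 * (ζ * (5 * n)) ^ 2 / δ) = ζ * τ := by
    rw [hτ, ht, hK]; field_simp; ring
  have htM : (n : ℝ) ^ 9 / (2 * t) ≤ M := by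
    refine le_trans (le_of_eq ?_) hM
    have h1 : ζ ^ (-1.6 : ℝ) = (ζ * p)⁻¹ := by
      rw [hp, ← Real.rpow_one_add' hζ_pos.le (by norm_num), ← Real.rpow_neg hζ_pos.le]
      norm_num
    rw [h1, ht]
    field_simp
  set U := nonresonant a (sortedEigenvalues hAH) ζ (5 * n) τ (n ^ 8) k with hU
  have hUm : MeasurableSet U := measurableSet_nonresonant
  have hUR : U ⊆ {G | G.IsHermitian ∧ frobeniusSq G ≤ (5 * (n : ℝ)) ^ 2} := fun G hG => hG.1
  have hR : 0 ≤ 5 * (n : ℝ) := by positivity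
  have hcount : ∀ G ∈ U, 1 / (4 * (α * n)) * M ≤ ((Finset.range M).filter fun i =>
      G ∈ {G | SeparatesEigenvalue α (A + (ζ : ℂ) • G) k i}).card := by
    intro G hG
    have hH := isHermitian_add_smul hAH (hUR hG).1 ζ
    refine (card_separates_ge hn hα hαn ht0 (l := sortedEigenvalues hH) (k := k) ?_ htM).trans ?_
    · intro j hj b c hb hc hbc
      exact le_distInt_of_mem_nonresonant hAH hd hδ hζ_pos hR hzR ha hG hzτ.le
        (by rw [hzτ, hK]; exact hsmall) hH hj hb hc hbc
    · gcongr with i _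
      exact fun hi => ⟨hH, hi⟩
  have hmain := mul_measureReal_le_of_card_ge hE hm hEm hM0 hUm
    (S := fun i => {G | SeparatesEigenvalue α (A + (ζ : ℂ) • G) k i})
    (fun i => measurableSet_inter_separates hAH hd hδ hζ_pos hR hzR hUm hUR α k i)
    (by positivity) hcount
  refine le_trans ?_ hmain
  -- The norm contributes `1/25` and the resonances at most `1/20`.
  have hUc : (gue n).real Uᶜ ≤ 1 / 10 := by
    refine (gue_nonresonant_compl_le (by positivity) hτ0).trans ?_
    have h25 : (n : ℝ) ^ 2 / (5 * n) ^ 2 = 1 / 25 := by field_simp; norm_num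
    rw [h25, hK]
    linarith
  rw [probReal_compl_eq_one_sub hUm] at hUc
  have hc0 : 0 < 1 / (α * n) := by positivity
  have e1 : 1 / (5 * α * n) = 1 / 5 * (1 / (α * n)) := by field_simp
  have e2 : 1 / (4 * (α * n)) = 1 / 4 * (1 / (α * n)) := by field_simp
  rw [e1, e2]
  nlinarith
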